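/- Consider the linear model $\mathbf Y = X\beta_\star+\varepsilon$ with fixed $X\in\mathbb R^{n\times d}$, square integrable noise with $\mathbb E[\varepsilon]=0$, $\mathrm{Cov}(\varepsilon)=I_n$. Write $\mathbb X:=X^\top X$, and for a $d\times d$ matrix $A$ let $\mathrm{Diag}(A)$ be the diagonal matrix with the same diagonal as $A$, $\overline A:=A-\mathrm{Diag}(A)$, $A_p:=pA+(1-p)\mathrm{Diag}(A)$; $\odot$ is the entrywise product, $\|\cdot\|$ the spectral norm and $\lambda_{\min}$ the smallest eigenvalue. Let $p\in(0,1)$, $\alpha>0$, and let $D_1,D_2,\dots$ be i.i.d. random diagonal $d\times d$ matrices with i.i.d. $\mathrm{Ber}(p)$ diagonal entries. Gradient descent with dropout is $$\tilde\beta_{k+1}=\tilde\beta_k+\alpha D_{k+1}X^\top\big(\mathbf Y-XD_{k+1}\tilde\beta_k\big),\qquad k=0,1,2,\dots,$$ where the initialization $\tilde\beta_0$ is square integrable and independent of $\mathbf Y$, and $(D_k)_{k\ge1}$ is independent of $(\mathbf Y,\tilde\beta_0)$. Assume that $X$ has no zero column, $\alpha p\|\mathbb X\|<1$ and $\alpha<\lambda_{\min}(\mathbb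 X_p)/(3\|\mathbb X\|^2)$. Let $\tilde\beta:=\mathbb X_p^{-1}X^\top\mathbf Y$, and $\tilde\beta^{\mathrm{rp}}_k:=\frac1k\sum_{\ell=1}^k\tilde\beta_\ell$. Then $\tilde\beta$ is the unique minimizer of the marginalized loss $\beta\mapsto\mathbb E[\|\mathbf Y-XD\beta\|_2^2\mid\mathbf Y]$ (with $D$ distributed as $D_1$ and independent of $\mathbf Y$), and for every $k=1,2,\dots$ the vector $\tilde\beta^{\mathrm{rp}}_k-\tilde\beta$ is square integrable with $$\Big\|\mathbb E\big[(\tilde\beta^{\mathrm{rp}}_k-\tilde\beta)(\tilde\beta^{\mathrm{rp}}_k-\tilde\beta)^\top\big]\Big\|\le\frac{2\|\mathbb X\|^2\,\big\|\mathbb E[X^\top\mathbf Y\mathbf Y^\top X]\big\|}{k(1-p)^3(\min_i\mathbb X_{ii})^4}+\frac{2C}{k^2\big(\alpha p(1-p)\min_i\mathbb X_{ii}\big)^3},$$ where $$C:=\Big\|\mathbb E\big[(\tilde\beta_0-\tilde\beta)(\tilde\beta_0-\tilde\beta)^\top\big]-(\mathrm{id}-S_{\mathrm{lin}})^{-1}S_0\Big\|+6\Big\|\mathbb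 E\big[(\tilde\beta_0-\tilde\beta)\tilde\beta^\top\big]\Big\|+\Big\|\mathbb E\big[\tilde\beta_0-\tilde\beta\big]\Big\|_2^2,$$ $S_0:=S(0)$, $S_{\mathrm{lin}}(A):=S(A)-S_0$, and $S$ is the affine operator on $\mathbb R^{d\times d}$ given, with $B:=\mathbb E[\tilde\beta\tilde\beta^\top]$, by $$\begin{aligned}S(A)={}&(I-\alpha p\mathbb X_p)A(I-\alpha p\mathbb X_p)+\alpha^2p(1-p)\mathrm{Diag}(\mathbb X_pA\mathbb X_p)+\alpha^2p^2(1-p)^2\,\mathbb X\odot\overline{A+B}\odot\mathbb X\\&+\alpha^2p^2(1-p)\Big(\big(\overline{\mathbb X}\,\mathrm{Diag}(A+B)\,\overline{\mathbb X}\big)_p+\overline{\mathbb X}\,\mathrm{Diag}(\mathbb X_pA)+\mathrm{Diag}(\mathbb X_pA)\,\overline{\mathbb X}\Big).\end{aligned}$$ In particular $\mathbb E\big[\|\tilde\beta^{\mathrm{rp}}_k-\tilde\beta\|_2^2\big]\to0$ as $k\to\infty$. -/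

import Mathlib

open MeasureTheory ProbabilityTheory Filter Topology
open scoped Matrix
-- The norm on matrices is the spectral norm, induced by the Euclidean norm.
open scoped Matrix.Norms.L2Operator

noncomputable section

namespace Dropout

variable {Ω : Type*} [MeasurableSpace Ω] {n d : ℕ}

/-- Squared Euclidean norm. -/
def sqNorm {m : ℕ} (v : Fin m → ℝ) : ℝ := ∑ i, v i ^ 2

/-- `Diag(A)`: the diagonal matrix with the same main diagonal as `A`. -/
def diagPart (A : Matrix (Fin d) (Fin d) ℝ) : Matrix (Fin d) (Fin d) ℝ :=
  Matrix.diagonal A.diag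

/-- `A - Diag(A)`. -/
def offDiag (A : Matrix (Fin d) (Fin d) ℝ) : Matrix (Fin d) (Fin d) ℝ :=
  A - diagPart A

/-- `A_p = p A + (1 - p) Diag(A)`. -/
def pPart (p : ℝ) (A : Matrix (Fin d) (Fin d) ℝ) : Matrix (Fin d) (Fin d) ℝ :=
  p • A + (1 - p) • diagPart A

/-- The Gram matrix `𝕏 = Xᵀ X`. -/
def gram (X : Matrix (Fin n) (Fin d) ℝ) : Matrix (Fin d) (Fin d) ℝ := Xᵀ * X

/-- Smallest eigenvalue of a symmetric matrix. -/
def lambdaMin (A : Matrix (Fin d) (Fin d) ℝ) : ℝ := sInf (spectrum ℝ A)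

/-- `min_i 𝕏_{ii}`. -/
def minDiag (A : Matrix (Fin d) (Fin d) ℝ) : ℝ := ⨅ i, A i i

/-- Entrywise expectation `E[U]` of a random vector. -/
def expVec {m : ℕ} (μ : Measure Ω) (U : Ω → Fin m → ℝ) : Fin m → ℝ :=
  fun i => ∫ ω, U ω i ∂μ

/-- Entrywise expectation `E[U Vᵀ]` for two random vectors. -/
def expOuter {m l : ℕ} (μ : Measure Ω) (U : Ω → Fin m → ℝ) (V : Ω → Fin l → ℝ) :
    Matrix (Fin m) (Fin l) ℝ :=
  Matrix.of fun i j => ∫ ω, U ω i * V ω j ∂μ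

/-- `U` is a square integrable random vector. -/
def SquareIntegrable {m : ℕ} (μ : Measure Ω) (U : Ω → Fin m → ℝ) : Prop :=
  ∀ i, MemLp (fun ω => U ω i) 2 μ

/-- A `p`-dropout matrix: a random diagonal matrix with i.i.d. `Ber(p)` diagonal entries. -/
structure IsDropoutMatrix (μ : Measure Ω) (p : unitInterval)
    (D : Ω → Matrix (Fin d) (Fin d) ℝ) : Prop where
  isDiag : ∀ ω, (D ω).IsDiag
  measurable : ∀ i, Measurable fun ω => D ω i i
  law : ∀ i, μ.map (fun ω => D ω i i) = bernoulliMeasure (1 : ℝ) 0 p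
  indep : iIndepFun (fun i ω => D ω i i) μ

/-- The marginalized loss `β ↦ E[‖y - X D β‖₂²]`, where the expectation is over the dropout
matrix `D` only and the data vector `y` is held fixed. -/
def marginalLoss (μ : Measure Ω) (X : Matrix (Fin n) (Fin d) ℝ)
    (D : Ω → Matrix (Fin d) (Fin d) ℝ) (y : Fin n → ℝ) (β : Fin d → ℝ) : ℝ :=
  ∫ ω, sqNorm (y - X *ᵥ (D ω *ᵥ β)) ∂μ

/-- `β̃ = 𝕏_p⁻¹ Xᵀ y`. -/
def betaTilde (p : ℝ) (X : Matrix (Fin n) (Fin d) ℝ) (y : Fin n → ℝ) : Fin d → ℝ :=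
  (pPart p (gram X))⁻¹ *ᵥ (Xᵀ *ᵥ y)

/-- Gradient descent with dropout. The matrix `D k` is the one used in the step from the `k`-th
to the `(k + 1)`-th iterate, so it is what is usually written `D_{k+1}`. -/
def iterate (α : ℝ) (X : Matrix (Fin n) (Fin d) ℝ) (D : ℕ → Ω → Matrix (Fin d) (Fin d) ℝ)
    (Y : Ω → Fin n → ℝ) (β₀ : Ω → Fin d → ℝ) : ℕ → Ω → Fin d → ℝ
  | 0 => β₀
  | k + 1 => fun ω =>
      iterate α X D Y β₀ k ω +
        α • (D k ω *ᵥ (Xᵀ *ᵥ (Y ω - X *ᵥ (D k ω *ᵥ iterate α X D Y β₀ k ω))))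

/-- Ruppert–Polyak average `k⁻¹ ∑_{ℓ=1}^k β̃_ℓ`. -/
def rpAverage (α : ℝ) (X : Matrix (Fin n) (Fin d) ℝ) (D : ℕ → Ω → Matrix (Fin d) (Fin d) ℝ)
    (Y : Ω → Fin n → ℝ) (β₀ : Ω → Fin d → ℝ) (k : ℕ) (ω : Ω) : Fin d → ℝ :=
  (k : ℝ)⁻¹ • ∑ l ∈ Finset.Icc 1 k, iterate α X D Y β₀ l ω

/-- The affine operator `S`, with `G = 𝕏` and `B = E[β̃ β̃ᵀ]`. -/
def opS (α p : ℝ) (G B A : Matrix (Fin d) (Fin d) ℝ) : Matrix (Fin d) (Fin d) ℝ :=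
  (1 - (α * p) • pPart p G) * A * (1 - (α * p) • pPart p G)
    + (α ^ 2 * p * (1 - p)) • diagPart (pPart p G * A * pPart p G)
    + (α ^ 2 * p ^ 2 * (1 - p) ^ 2) • (G ⊙ offDiag (A + B) ⊙ G)
    + (α ^ 2 * p ^ 2 * (1 - p)) •
        (pPart p (offDiag G * diagPart (A + B) * offDiag G)
          + offDiag G * diagPart (pPart p G * A)
          + diagPart (pPart p G * A) * offDiag G)

theorem diagPart_add (A B : Matrix (Fin d) (Fin d) ℝ) :
    diagPart (A + B) = diagPart A + diagPart B := by
  simp [diagPart, Matrix.diag_add, Matrix.diagonal_add]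

theorem diagPart_smul (c : ℝ) (A : Matrix (Fin d) (Fin d) ℝ) :
    diagPart (c • A) = c • diagPart A := by
  simp [diagPart, Matrix.diag_smul, Matrix.diagonal_smul]

theorem offDiag_add (A B : Matrix (Fin d) (Fin d) ℝ) :
    offDiag (A + B) = offDiag A + offDiag B := by
  simp only [offDiag, diagPart_add]; abel

theorem offDiag_smul (c : ℝ) (A : Matrix (Fin d) (Fin d) ℝ) :
    offDiag (c • A) = c • offDiag A := by
  simp only [offDiag, diagPart_smul, smul_sub]

theorem pPart_add (p : ℝ) (A B : Matrix (Fin d) (Fin d) ℝ) :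
    pPart p (A + B) = pPart p A + pPart p B := by
  simp only [pPart, diagPart_add, smul_add]; abel

theorem pPart_smul (p c : ℝ) (A : Matrix (Fin d) (Fin d) ℝ) :
    pPart p (c • A) = c • pPart p A := by
  simp only [pPart, diagPart_smul]; module

theorem opS_zero (α p : ℝ) (G B : Matrix (Fin d) (Fin d) ℝ) :
    opS α p G B 0 = (α ^ 2 * p ^ 2 * (1 - p) ^ 2) • (G ⊙ offDiag B ⊙ G)
      + (α ^ 2 * p ^ 2 * (1 - p)) • pPart p (offDiag G * diagPart B * offDiag G) := by
  simp [opS, diagPart]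

/-- The linear part is unaffected by `B`. -/
theorem opS_sub_zero (α p : ℝ) (G B A : Matrix (Fin d) (Fin d) ℝ) :
    opS α p G B A - opS α p G B 0 = opS α p G 0 A := by
  rw [opS_zero]
  simp only [opS, diagPart_add, offDiag_add, pPart_add, add_zero, mul_add, add_mul,
    Matrix.hadamard_add, Matrix.add_hadamard, smul_add]
  abel

/-- The linear part `S_lin(A) = S(A) - S(0)` of `S`. -/
def opSLin (α p : ℝ) (G B : Matrix (Fin d) (Fin d) ℝ) :
    Module.End ℝ (Matrix (Fin d) (Fin d) ℝ) where
  toFun A := opS α p G B A - opS α p G B 0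
  map_add' A A' := by
    simp only [opS_sub_zero]
    simp only [opS, diagPart_add, offDiag_add, pPart_add, add_zero, mul_add, add_mul,
      Matrix.hadamard_add, Matrix.add_hadamard, smul_add]
    abel
  map_smul' c A := by
    simp only [opS_sub_zero, RingHom.id_apply]
    simp only [opS, add_zero, Matrix.mul_smul, Matrix.smul_mul, diagPart_smul, offDiag_smul,
      pPart_smul, Matrix.hadamard_smul, Matrix.smul_hadamard, smul_add,
      smul_comm _ c]

/-- `(id - S_lin)⁻¹ S₀` with `S₀ = S(0)`. -/
def limitMatrix (α p : ℝ) (G B : Matrix (Fin d) (Fin d) ℝ) : Matrix (Fin d) (Fin d) ℝ :=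
  Ring.inverse (1 - opSLin α p G B) (opS α p G B 0)

/-- The constant
`C = ‖E[(β₀ - β̃)(β₀ - β̃)ᵀ] - (id - S_lin)⁻¹ S₀‖ + 6 ‖E[(β₀ - β̃) β̃ᵀ]‖ + ‖E[β₀ - β̃]‖₂²`. -/
def constC (μ : Measure Ω) (α p : ℝ) (X : Matrix (Fin n) (Fin d) ℝ)
    (Y : Ω → Fin n → ℝ) (β₀ : Ω → Fin d → ℝ) : ℝ :=
  let βt : Ω → Fin d → ℝ := fun ω => betaTilde p X (Y ω)
  let Z : Ω → Fin d → ℝ := fun ω => β₀ ω - βt ω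
  ‖expOuter μ Z Z - limitMatrix α p (gram X) (expOuter μ βt βt)‖
    + 6 * ‖expOuter μ Z βt‖ + sqNorm (expVec μ Z)

end Dropout

end

/-!
The error `Z k = β̃ k - β̃` satisfies `Z (k + 1) = M k Z k + N k β̃`, where the random coefficients
`(M k, N k)` are independent of the past and `N k` is centered. Hence `E[Z k β̃ᵀ]` and the
autocovariances `E[Z (l + j) (Z l)ᵀ]` decay in `j` at the geometric rate
`q = 1 - α p lambdaMin 𝕏_p`, since they are only ever multiplied by `E[M] = 1 - α p 𝕏_p`.
The second moments `E[Z k (Z k)ᵀ]` follow the affine map `S`, a `q`-contraction, up to cross terms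
controlled by `E[Z k β̃ᵀ]`, and so approach the fixed point `(id - S_lin)⁻¹ S(0)` geometrically.

The second moment of the average is a double sum of autocovariances, which the geometric decay
bounds by `2 / (1 - q)` times the diagonal sum. The fixed point, of norm at most
`‖S(0)‖ / (1 - q)`, produces the `1 / k` term, and the summable deviations from it produce the
`1 / k ^ 2` term; both are made explicit by `lambdaMin 𝕏_p ≥ (1 - p) minDiag 𝕏`.
-/

noncomputable section

namespace Dropout

local instance {ι κ : Type*} : MeasurableSpace (Matrix ι κ ℝ) := MeasurableSpace.pi

/-! ### The spectral norm and quadratic forms -/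

section SpectralNorm

theorem isSymm_of_posSemidef {m : Type*} {A : Matrix m m ℝ} (hA : A.PosSemidef) : A.IsSymm :=
  Matrix.isHermitian_iff_isSymm.1 hA.isHermitian

variable {m n : Type*} [Fintype m] [Fintype n] [DecidableEq n]

theorem norm_toLp_sq (v : m → ℝ) : ‖WithLp.toLp 2 v‖ ^ 2 = v ⬝ᵥ v := by
  rw [EuclideanSpace.real_norm_sq_eq]
  simp only [dotProduct, pow_two]

theorem dotProduct_self_nonneg (v : m → ℝ) : 0 ≤ v ⬝ᵥ v := by
  rw [← norm_toLp_sq]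
  positivity

theorem dotProduct_self_pos {v : m → ℝ} (hv : v ≠ 0) : 0 < v ⬝ᵥ v :=
  (dotProduct_self_nonneg v).lt_of_ne' (dotProduct_self_eq_zero.not.2 hv)

theorem two_mul_dotProduct_mulVec_le (A : Matrix m n ℝ) (u : m → ℝ) (v : n → ℝ) :
    2 * (u ⬝ᵥ A *ᵥ v) ≤ ‖A‖ * (u ⬝ᵥ u + v ⬝ᵥ v) := by
  have h_inner : u ⬝ᵥ A *ᵥ v ≤ ‖WithLp.toLp 2 u‖ * ‖WithLp.toLp 2 (A *ᵥ v)‖ := by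
    simpa [PiLp.inner_apply, dotProduct, mul_comm] using
      real_inner_le_norm (WithLp.toLp 2 u) (WithLp.toLp 2 (A *ᵥ v))
  have h_op : ‖WithLp.toLp 2 (A *ᵥ v)‖ ≤ ‖A‖ * ‖WithLp.toLp 2 v‖ :=
    Matrix.l2_opNorm_mulVec A (WithLp.toLp 2 v)
  rw [← norm_toLp_sq u, ← norm_toLp_sq v]
  have h_mul := mul_le_mul_of_nonneg_left h_op (norm_nonneg (WithLp.toLp 2 u))
  have h_sq := mul_nonneg (norm_nonneg A)
    (sq_nonneg (‖WithLp.toLp 2 u‖ - ‖WithLp.toLp 2 v‖))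
  linarith

theorem dotProduct_mulVec_self_le (A : Matrix n n ℝ) (v : n → ℝ) :
    v ⬝ᵥ A *ᵥ v ≤ ‖A‖ * (v ⬝ᵥ v) := by
  linarith [two_mul_dotProduct_mulVec_le A v v]

theorem norm_le_of_mulVec_dotProduct_mulVec_le {A : Matrix m n ℝ} {c : ℝ} (hc : 0 ≤ c)
    (h : ∀ v, A *ᵥ v ⬝ᵥ A *ᵥ v ≤ c ^ 2 * (v ⬝ᵥ v)) : ‖A‖ ≤ c := by
  rw [Matrix.l2_opNorm_def]
  refine ContinuousLinearMap.opNorm_le_bound _ hc fun x => ?_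
  have hx : ‖WithLp.toLp 2 (A *ᵥ x.ofLp)‖ ^ 2 ≤ (c * ‖WithLp.toLp 2 x.ofLp‖) ^ 2 := by
    rw [mul_pow, norm_toLp_sq, norm_toLp_sq]
    exact h x.ofLp
  exact le_of_sq_le_sq hx (by positivity)

theorem norm_le_of_two_mul_dotProduct_mulVec_le {A : Matrix m n ℝ} {c : ℝ} (hc : 0 ≤ c)
    (h : ∀ u v, 2 * (u ⬝ᵥ A *ᵥ v) ≤ c * (u ⬝ᵥ u + v ⬝ᵥ v)) : ‖A‖ ≤ c := by
  refine norm_le_of_mulVec_dotProduct_mulVec_le hc fun v => ?_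
  rcases hc.eq_or_lt with rfl | hc
  · linarith [h (A *ᵥ v) v]
  · have h_scaled := h (c⁻¹ • A *ᵥ v) v
    simp only [smul_dotProduct, dotProduct_smul, smul_eq_mul] at h_scaled
    field_simp at h_scaled
    linarith

theorem dotProduct_mulVec_comm {A : Matrix m m ℝ} (hA : A.IsSymm) (u v : m → ℝ) :
    u ⬝ᵥ A *ᵥ v = v ⬝ᵥ A *ᵥ u := by
  rw [Matrix.dotProduct_mulVec, dotProduct_comm, ← Matrix.mulVec_transpose, hA.eq]

theorem dotProduct_mulVec_nonneg_of_posSemidef {A : Matrix m m ℝ} (hA : A.PosSemidef)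
    (v : m → ℝ) : 0 ≤ v ⬝ᵥ A *ᵥ v := by
  simpa only [star_trivial] using hA.dotProduct_mulVec_nonneg v

theorem norm_le_of_abs_dotProduct_mulVec_le {A : Matrix n n ℝ} (hA : A.IsSymm) {c : ℝ}
    (hc : 0 ≤ c) (h : ∀ v, |v ⬝ᵥ A *ᵥ v| ≤ c * (v ⬝ᵥ v)) : ‖A‖ ≤ c := by
  refine norm_le_of_two_mul_dotProduct_mulVec_le hc fun u v => ?_
  -- Polarization: `4 uᵀ A v` is the difference of the quadratic forms at `u + v` and `u - v`.
  have h_add := (abs_le.1 (h (u + v))).2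
  have h_sub := (abs_le.1 (h (u - v))).1
  simp only [Matrix.mulVec_add, Matrix.mulVec_sub, dotProduct_add, add_dotProduct, dotProduct_sub,
    sub_dotProduct] at h_add h_sub
  linarith [dotProduct_mulVec_comm hA u v, dotProduct_comm u v]

theorem norm_transpose [DecidableEq m] (A : Matrix m n ℝ) : ‖Aᵀ‖ = ‖A‖ := by
  rw [← Matrix.conjTranspose_eq_transpose_of_trivial, Matrix.l2_opNorm_conjTranspose]

theorem abs_apply_le_norm (A : Matrix m n ℝ) (i : m) (j : n) : |A i j| ≤ ‖A‖ := by
  classical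
  have h_pos := two_mul_dotProduct_mulVec_le A (Pi.single i 1) (Pi.single j 1)
  have h_neg := two_mul_dotProduct_mulVec_le A (-Pi.single i 1) (Pi.single j 1)
  simp only [single_one_dotProduct, Matrix.mulVec_single_one, Matrix.col_apply, Pi.single_eq_same,
    neg_dotProduct, dotProduct_neg, neg_neg] at h_pos h_neg
  exact abs_le.2 ⟨by linarith, by linarith⟩

theorem isUnit_of_coercive {A : Matrix n n ℝ} {c : ℝ} (hc : 0 < c)
    (h : ∀ v, c * (v ⬝ᵥ v) ≤ v ⬝ᵥ A *ᵥ v) : IsUnit A := by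
  rw [← Matrix.mulVec_injective_iff_isUnit, ← Matrix.coe_mulVecLin, ← LinearMap.ker_eq_bot,
    LinearMap.ker_eq_bot']
  intro v hv
  rw [Matrix.mulVecLin_apply] at hv
  by_contra hne
  have h_pos := (mul_pos hc (dotProduct_self_pos hne)).trans_le (h v)
  rw [hv, dotProduct_zero] at h_pos
  exact lt_irrefl _ h_pos

theorem norm_inv_le_of_coercive {A : Matrix n n ℝ} {c : ℝ} (hc : 0 < c)
    (h : ∀ v, c * (v ⬝ᵥ v) ≤ v ⬝ᵥ A *ᵥ v) : ‖A⁻¹‖ ≤ c⁻¹ := by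
  refine norm_le_of_mulVec_dotProduct_mulVec_le (by positivity) fun v => ?_
  set w := A⁻¹ *ᵥ v with hw
  have hAw : A *ᵥ w = v := by
    rw [hw, Matrix.mulVec_mulVec, Matrix.mul_nonsing_inv _
      ((Matrix.isUnit_iff_isUnit_det _).1 (isUnit_of_coercive hc h)), Matrix.one_mulVec]
  have h_coercive := mul_le_mul_of_nonneg_left (h w) hc.le
  have h_sq := dotProduct_self_nonneg (v - c • w)
  simp only [sub_dotProduct, dotProduct_sub, smul_dotProduct, dotProduct_smul, smul_eq_mul,
    dotProduct_comm v w] at h_sq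
  rw [hAw] at h_coercive
  rw [inv_pow, ← div_eq_inv_mul, le_div_iff₀ (by positivity)]
  linarith

end SpectralNorm

/-! ### Integrals of random matrices -/

section MatrixIntegral

variable {Ω : Type*} [MeasurableSpace Ω] {μ : Measure Ω}
  {m n : Type*} [Fintype m] [Fintype n] [DecidableEq n]

theorem integrable_dotProduct_mulVec {F : Ω → Matrix m n ℝ} (hF : Integrable F μ)
    (u : m → ℝ) (v : n → ℝ) : Integrable (fun ω => u ⬝ᵥ F ω *ᵥ v) μ :=
  ((dotProductBilin ℝ ℝ u).comp
    ((Matrix.mulVecBilin ℝ ℝ).flip v)).toContinuousLinearMap.integrable_comp hF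

theorem integral_dotProduct_mulVec {F : Ω → Matrix m n ℝ} (hF : Integrable F μ)
    (u : m → ℝ) (v : n → ℝ) :
    ∫ ω, u ⬝ᵥ F ω *ᵥ v ∂μ = u ⬝ᵥ (∫ ω, F ω ∂μ) *ᵥ v :=
  ((dotProductBilin ℝ ℝ u).comp
    ((Matrix.mulVecBilin ℝ ℝ).flip v)).toContinuousLinearMap.integral_comp_comm hF

theorem norm_integral_mul_mul_transpose_le [DecidableEq m] {F : Ω → Matrix m n ℝ}
    {A : Matrix n n ℝ} (hFA : Integrable (fun ω => F ω * A * (F ω)ᵀ) μ)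
    (hF : Integrable (fun ω => F ω * (F ω)ᵀ) μ) :
    ‖∫ ω, F ω * A * (F ω)ᵀ ∂μ‖ ≤ ‖A‖ * ‖∫ ω, F ω * (F ω)ᵀ ∂μ‖ := by
  have h_int (u : m → ℝ) : Integrable (fun ω => u ⬝ᵥ (F ω * (F ω)ᵀ) *ᵥ u) μ :=
    integrable_dotProduct_mulVec hF u u
  refine norm_le_of_two_mul_dotProduct_mulVec_le (by positivity) fun u v => ?_
  have h_pointwise (ω : Ω) : 2 * (u ⬝ᵥ (F ω * A * (F ω)ᵀ) *ᵥ v)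
      ≤ ‖A‖ * (u ⬝ᵥ (F ω * (F ω)ᵀ) *ᵥ u + v ⬝ᵥ (F ω * (F ω)ᵀ) *ᵥ v) := by
    simpa only [← Matrix.mulVec_mulVec, Matrix.dotProduct_mulVec u, Matrix.dotProduct_mulVec v,
      Matrix.mulVec_transpose] using
      two_mul_dotProduct_mulVec_le A ((F ω)ᵀ *ᵥ u) ((F ω)ᵀ *ᵥ v)
  calc 2 * (u ⬝ᵥ (∫ ω, F ω * A * (F ω)ᵀ ∂μ) *ᵥ v)
      = ∫ ω, 2 * (u ⬝ᵥ (F ω * A * (F ω)ᵀ) *ᵥ v) ∂μ := by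
        rw [integral_const_mul, integral_dotProduct_mulVec hFA]
    _ ≤ ∫ ω, ‖A‖ * (u ⬝ᵥ (F ω * (F ω)ᵀ) *ᵥ u + v ⬝ᵥ (F ω * (F ω)ᵀ) *ᵥ v) ∂μ :=
        integral_mono ((integrable_dotProduct_mulVec hFA u v).const_mul 2)
          (((h_int u).add (h_int v)).const_mul _) h_pointwise
    _ = ‖A‖ * (u ⬝ᵥ (∫ ω, F ω * (F ω)ᵀ ∂μ) *ᵥ u + v ⬝ᵥ (∫ ω, F ω * (F ω)ᵀ ∂μ) *ᵥ v) := by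
        rw [integral_const_mul, integral_add (h_int u) (h_int v), integral_dotProduct_mulVec hF,
          integral_dotProduct_mulVec hF]
    _ ≤ ‖A‖ * (‖∫ ω, F ω * (F ω)ᵀ ∂μ‖ * (u ⬝ᵥ u) + ‖∫ ω, F ω * (F ω)ᵀ ∂μ‖ * (v ⬝ᵥ v)) := by
        gcongr <;> exact dotProduct_mulVec_self_le _ _
    _ = _ := by ring

theorem memLp_matrix_apply {p : ENNReal} {F : Ω → Matrix m n ℝ} (hF : MemLp F p μ)
    (i : m) (j : n) : MemLp (fun ω => F ω i j) p μ :=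
  (Matrix.entryLinearMap ℝ ℝ i j).toContinuousLinearMap.comp_memLp' hF

theorem integral_matrix_apply {F : Ω → Matrix m n ℝ} (hF : Integrable F μ) (i : m) (j : n) :
    (∫ ω, F ω ∂μ) i j = ∫ ω, F ω i j ∂μ :=
  ((Matrix.entryLinearMap ℝ ℝ i j).toContinuousLinearMap.integral_comp_comm hF).symm

variable [DecidableEq m]

theorem memLp_matrix_transpose {p : ENNReal} {F : Ω → Matrix m n ℝ} (hF : MemLp F p μ) :
    MemLp (fun ω => (F ω)ᵀ) p μ :=
  (Matrix.transposeLinearEquiv m n ℝ ℝ).toLinearMap.toContinuousLinearMap.comp_memLp' hF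

variable {k l : Type*} [Fintype k] [Fintype l]

theorem memLp_top_matrix_mul {F : Ω → Matrix l m ℝ} {G : Ω → Matrix m n ℝ}
    (hF : MemLp F ⊤ μ) (hG : MemLp G ⊤ μ) : MemLp (fun ω => F ω * G ω) ⊤ μ :=
  (mulLinearMap (l := l) (m := m) (n := n) (A := ℝ) ℝ).toContinuousBilinearMap.memLp_of_bilin ⊤
    hF hG

variable [IsFiniteMeasure μ] {R : Ω → Matrix l m ℝ} {R' : Ω → Matrix k n ℝ}

theorem integrable_apply_mul_apply (hR : MemLp R ⊤ μ) (hR' : MemLp R' ⊤ μ)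
    (i : l) (a : m) (j : k) (b : n) : Integrable (fun ω => R ω i a * R' ω j b) μ :=
  ((memLp_matrix_apply hR' j b).mul (r := ⊤) (memLp_matrix_apply hR i a)).integrable le_top

theorem integral_mul_mul_transpose_apply [DecidableEq k] (hR : MemLp R ⊤ μ) (hR' : MemLp R' ⊤ μ)
    (A : Matrix m n ℝ) (i : l) (j : k) :
    (∫ ω, R ω * A * (R' ω)ᵀ ∂μ) i j = ∑ a, ∑ b, (∫ ω, R ω i a * R' ω j b ∂μ) * A a b := by
  have h_integrable : Integrable (fun ω => R ω * A * (R' ω)ᵀ) μ :=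
    (memLp_top_matrix_mul (memLp_top_matrix_mul hR (memLp_top_const _))
      (memLp_matrix_transpose hR')).integrable le_top
  have h_term (a : m) (b : n) : Integrable (fun ω => R ω i a * R' ω j b * A a b) μ :=
    (integrable_apply_mul_apply hR hR' i a j b).mul_const _
  have h_entry (ω : Ω) :
      (R ω * A * (R' ω)ᵀ) i j = ∑ a, ∑ b, R ω i a * R' ω j b * A a b := by
    simp only [Matrix.mul_apply, Matrix.transpose_apply, Finset.sum_mul]
    rw [Finset.sum_comm]
    exact Finset.sum_congr rfl fun a _ => Finset.sum_congr rfl fun b _ => by ring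
  simp_rw [integral_matrix_apply h_integrable, h_entry, ← integral_mul_const]
  rw [integral_finsetSum _ fun a _ => integrable_finsetSum _ fun b _ => h_term a b]
  exact Finset.sum_congr rfl fun a _ => integral_finsetSum _ fun b _ => h_term a b

end MatrixIntegral

/-! ### Second moments of random vectors -/

section SecondMoment

variable {Ω : Type*} [MeasurableSpace Ω] {μ : Measure Ω} {m l : ℕ}
  {U U' : Ω → Fin m → ℝ} {V V' : Ω → Fin l → ℝ}

theorem SquareIntegrable.add (hU : SquareIntegrable μ U) (hU' : SquareIntegrable μ U') :
    SquareIntegrable μ fun ω => U ω + U' ω :=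
  fun i => (hU i).add (hU' i)

theorem SquareIntegrable.sub (hU : SquareIntegrable μ U) (hU' : SquareIntegrable μ U') :
    SquareIntegrable μ fun ω => U ω - U' ω :=
  fun i => (hU i).sub (hU' i)

theorem SquareIntegrable.integrable_mul (hU : SquareIntegrable μ U) (hV : SquareIntegrable μ V)
    (i : Fin m) (j : Fin l) : Integrable (fun ω => U ω i * V ω j) μ :=
  (hU i).integrable_mul (hV j)

theorem SquareIntegrable.mulVec {R : Ω → Matrix (Fin l) (Fin m) ℝ} (hR : MemLp R ⊤ μ)
    (hU : SquareIntegrable μ U) : SquareIntegrable μ fun ω => R ω *ᵥ U ω :=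
  memLp_pi_iff.1 <| (Matrix.mulVecBilin (m := Fin l) (n := Fin m) (A := ℝ) ℝ ℝ)
    |>.toContinuousBilinearMap.memLp_of_bilin 2 hR (memLp_pi_iff.2 hU)

theorem expOuter_congr_ae (hU : U =ᵐ[μ] U') (hV : V =ᵐ[μ] V') :
    expOuter μ U V = expOuter μ U' V' := by
  ext i j
  refine integral_congr_ae ?_
  filter_upwards [hU, hV] with ω h h'
  rw [h, h']

theorem transpose_expOuter (U : Ω → Fin m → ℝ) (V : Ω → Fin l → ℝ) :
    (expOuter μ U V)ᵀ = expOuter μ V U := by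
  ext i j
  simp only [expOuter, Matrix.of_apply, Matrix.transpose_apply, mul_comm]

theorem isSymm_expOuter (U : Ω → Fin m → ℝ) : (expOuter μ U U).IsSymm :=
  transpose_expOuter U U

theorem expOuter_add_left (hU : SquareIntegrable μ U) (hU' : SquareIntegrable μ U')
    (hV : SquareIntegrable μ V) :
    expOuter μ (fun ω => U ω + U' ω) V = expOuter μ U V + expOuter μ U' V := by
  ext i j
  simp only [expOuter, Matrix.of_apply, Matrix.add_apply, Pi.add_apply, add_mul]
  exact integral_add (hU.integrable_mul hV i j) (hU'.integrable_mul hV i j)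

theorem expOuter_add_right (hU : SquareIntegrable μ U) (hV : SquareIntegrable μ V)
    (hV' : SquareIntegrable μ V') :
    expOuter μ U (fun ω => V ω + V' ω) = expOuter μ U V + expOuter μ U V' := by
  simp only [← transpose_expOuter _ U, expOuter_add_left hV hV' hU, Matrix.transpose_add]

theorem expOuter_mulVec_mulVec [IsFiniteMeasure μ] {m' l' : ℕ}
    {R : Ω → Matrix (Fin m') (Fin m) ℝ} {R' : Ω → Matrix (Fin l') (Fin l) ℝ}
    (hR : MemLp R ⊤ μ) (hR' : MemLp R' ⊤ μ) (hU : SquareIntegrable μ U)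
    (hV : SquareIntegrable μ V)
    (hindep : IndepFun (fun ω => (R ω, R' ω)) (fun ω => (U ω, V ω)) μ) :
    expOuter μ (fun ω => R ω *ᵥ U ω) (fun ω => R' ω *ᵥ V ω)
      = ∫ ω, R ω * expOuter μ U V * (R' ω)ᵀ ∂μ := by
  ext i j
  have h_indep (a : Fin m) (b : Fin l) :
      IndepFun (fun ω => R ω i a * R' ω j b) (fun ω => U ω a * V ω b) μ := by
    have h_entry {r s : ℕ} (c : Fin r) (e : Fin s) :
        Measurable fun A : Matrix (Fin r) (Fin s) ℝ => A c e :=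
      (measurable_pi_apply e).comp (measurable_pi_apply c)
    exact hindep.comp (((h_entry i a).comp measurable_fst).mul ((h_entry j b).comp measurable_snd))
      (((measurable_pi_apply a).comp measurable_fst).mul
        ((measurable_pi_apply b).comp measurable_snd))
  have h_term (a : Fin m) (b : Fin l) :
      Integrable (fun ω => R ω i a * R' ω j b * (U ω a * V ω b)) μ :=
    (h_indep a b).integrable_mul (integrable_apply_mul_apply hR hR' i a j b)
      (hU.integrable_mul hV a b)
  calc ∫ ω, (R ω *ᵥ U ω) i * (R' ω *ᵥ V ω) j ∂μ
      = ∫ ω, ∑ a, ∑ b, R ω i a * R' ω j b * (U ω a * V ω b) ∂μ := by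
        simp only [Matrix.mulVec, dotProduct, Finset.sum_mul_sum, mul_mul_mul_comm]
    _ = ∑ a, ∑ b, ∫ ω, R ω i a * R' ω j b * (U ω a * V ω b) ∂μ := by
        rw [integral_finsetSum _ fun a _ => integrable_finsetSum _ fun b _ => h_term a b]
        exact Finset.sum_congr rfl fun a _ => integral_finsetSum _ fun b _ => h_term a b
    _ = ∑ a, ∑ b, (∫ ω, R ω i a * R' ω j b ∂μ) * expOuter μ U V a b := by
        refine Finset.sum_congr rfl fun a _ => Finset.sum_congr rfl fun b _ => ?_
        exact (h_indep a b).integral_fun_mul_eq_mul_integral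
          (integrable_apply_mul_apply hR hR' i a j b).1 (hU.integrable_mul hV a b).1
    _ = (∫ ω, R ω * expOuter μ U V * (R' ω)ᵀ ∂μ) i j :=
        (integral_mul_mul_transpose_apply hR hR' _ i j).symm

theorem expOuter_smul_sum {ι : Type*} {Z : ι → Ω → Fin m → ℝ}
    (hZ : ∀ l, SquareIntegrable μ (Z l)) (c : ℝ) (s : Finset ι) :
    expOuter μ (fun ω => c • ∑ l ∈ s, Z l ω) (fun ω => c • ∑ l ∈ s, Z l ω)
      = c ^ 2 • ∑ l ∈ s, ∑ l' ∈ s, expOuter μ (Z l) (Z l') := by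
  ext i j
  simp only [expOuter, Matrix.of_apply, Matrix.smul_apply, Matrix.sum_apply, Pi.smul_apply,
    Finset.sum_apply, smul_eq_mul, mul_mul_mul_comm c, ← sq, Finset.sum_mul_sum]
  rw [integral_const_mul, integral_finsetSum _ fun l _ => integrable_finsetSum _ fun l' _ =>
    (hZ l).integrable_mul (hZ l') i j]
  simp only [integral_finsetSum _ fun l' _ => (hZ _).integrable_mul (hZ l') i j]

theorem expOuter_mulVec_left [IsFiniteMeasure μ] {d : ℕ} {R : Ω → Matrix (Fin d) (Fin m) ℝ}
    (hR : MemLp R ⊤ μ) (hU : SquareIntegrable μ U)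
    (hV : SquareIntegrable μ V) (hindep : IndepFun R (fun ω => (U ω, V ω)) μ) :
    expOuter μ (fun ω => R ω *ᵥ U ω) V = (∫ ω, R ω ∂μ) * expOuter μ U V := by
  have h_pair : IndepFun (fun ω => (R ω, (1 : Matrix (Fin l) (Fin l) ℝ)))
      (fun ω => (U ω, V ω)) μ :=
    hindep.comp (measurable_id.prodMk measurable_const) measurable_id
  have h_outer := expOuter_mulVec_mulVec hR (memLp_top_const 1) hU hV h_pair
  simp only [Matrix.one_mulVec, Matrix.transpose_one, Matrix.mul_one] at h_outer
  rw [h_outer]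
  exact ((mulLinearMap (l := Fin d) (m := Fin m) (n := Fin l) (A := ℝ) ℝ).flip
    (expOuter μ U V)).toContinuousLinearMap.integral_comp_comm (hR.integrable le_top)

end SecondMoment

/-! ### Diagonal and off-diagonal parts -/

section Parts

variable {d : ℕ} {A G : Matrix (Fin d) (Fin d) ℝ} {p : ℝ}

theorem diagPart_apply (A : Matrix (Fin d) (Fin d) ℝ) (i j : Fin d) :
    diagPart A i j = if i = j then A i i else 0 := by
  rw [diagPart, Matrix.diagonal_apply, Matrix.diag_apply]

theorem offDiag_apply (A : Matrix (Fin d) (Fin d) ℝ) (i j : Fin d) :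
    offDiag A i j = if i = j then 0 else A i j := by
  rw [offDiag, Matrix.sub_apply, diagPart_apply]
  split_ifs with h
  · rw [h, sub_self]
  · rw [sub_zero]

theorem pPart_apply (p : ℝ) (A : Matrix (Fin d) (Fin d) ℝ) (i j : Fin d) :
    pPart p A i j = if i = j then A i i else p * A i j := by
  simp only [pPart, Matrix.add_apply, Matrix.smul_apply, diagPart_apply, smul_eq_mul]
  split_ifs with h
  · subst h; ring
  · ring

theorem diagPart_diagonal (x : Fin d → ℝ) :
    diagPart (Matrix.diagonal x) = Matrix.diagonal x := by
  rw [diagPart, Matrix.diag_diagonal]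

theorem diagPart_one : diagPart (1 : Matrix (Fin d) (Fin d) ℝ) = 1 :=
  diagPart_diagonal 1

theorem offDiag_one : offDiag (1 : Matrix (Fin d) (Fin d) ℝ) = 0 := by
  rw [offDiag, diagPart_one, sub_self]

theorem pPart_one : pPart p (1 : Matrix (Fin d) (Fin d) ℝ) = 1 := by
  rw [pPart, diagPart_one]
  module

theorem diagPart_offDiag (A : Matrix (Fin d) (Fin d) ℝ) : diagPart (offDiag A) = 0 := by
  ext i j
  simp only [diagPart_apply, offDiag_apply, if_true, ite_self, Matrix.zero_apply]

theorem offDiag_offDiag (A : Matrix (Fin d) (Fin d) ℝ) : offDiag (offDiag A) = offDiag A := by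
  rw [offDiag, diagPart_offDiag, sub_zero]

theorem pPart_eq_smul {A : Matrix (Fin d) (Fin d) ℝ} (hA : diagPart A = 0) :
    pPart p A = p • A := by
  rw [pPart, hA, smul_zero, add_zero]

theorem pPart_offDiag (A : Matrix (Fin d) (Fin d) ℝ) : pPart p (offDiag A) = p • offDiag A :=
  pPart_eq_smul (diagPart_offDiag A)

theorem isSymm_diagPart (A : Matrix (Fin d) (Fin d) ℝ) : (diagPart A).IsSymm :=
  Matrix.diagonal_transpose _

theorem isSymm_offDiag (hA : A.IsSymm) : (offDiag A).IsSymm :=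
  hA.sub (isSymm_diagPart A)

theorem isSymm_pPart (p : ℝ) (hA : A.IsSymm) : (pPart p A).IsSymm :=
  (hA.smul p).add ((isSymm_diagPart A).smul (1 - p))

theorem norm_diagPart_le (A : Matrix (Fin d) (Fin d) ℝ) : ‖diagPart A‖ ≤ ‖A‖ := by
  rw [diagPart, Matrix.l2_opNorm_diagonal, pi_norm_le_iff_of_nonneg (norm_nonneg _)]
  exact fun i => abs_apply_le_norm A i i

theorem norm_offDiag_le_two_mul (A : Matrix (Fin d) (Fin d) ℝ) : ‖offDiag A‖ ≤ 2 * ‖A‖ := by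
  have h_sub : ‖offDiag A‖ ≤ ‖A‖ + ‖diagPart A‖ := norm_sub_le _ _
  linarith [norm_diagPart_le A]

theorem norm_pPart_le (hp0 : 0 ≤ p) (hp1 : p ≤ 1) (A : Matrix (Fin d) (Fin d) ℝ) :
    ‖pPart p A‖ ≤ ‖A‖ := by
  have hp1' := sub_nonneg.2 hp1
  calc ‖pPart p A‖ ≤ ‖p • A‖ + ‖(1 - p) • diagPart A‖ := norm_add_le _ _
    _ = p * ‖A‖ + (1 - p) * ‖diagPart A‖ := by
      rw [norm_smul, norm_smul, Real.norm_of_nonneg hp0, Real.norm_of_nonneg hp1']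
    _ ≤ p * ‖A‖ + (1 - p) * ‖A‖ := by gcongr; exact norm_diagPart_le A
    _ = ‖A‖ := by ring

theorem dotProduct_diagPart_mulVec (A : Matrix (Fin d) (Fin d) ℝ) (v : Fin d → ℝ) :
    v ⬝ᵥ diagPart A *ᵥ v = ∑ i, A i i * v i ^ 2 := by
  simp only [diagPart, dotProduct, Matrix.mulVec_diagonal, Matrix.diag_apply]
  exact Finset.sum_congr rfl fun i _ => by ring

theorem norm_offDiag_le_of_posSemidef (hG : G.PosSemidef) : ‖offDiag G‖ ≤ ‖G‖ := by
  refine norm_le_of_abs_dotProduct_mulVec_le (isSymm_offDiag (isSymm_of_posSemidef hG))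
    (norm_nonneg _) fun v => ?_
  have h_diag_nonneg : 0 ≤ v ⬝ᵥ diagPart G *ᵥ v := by
    rw [dotProduct_diagPart_mulVec]
    exact Finset.sum_nonneg fun i _ => mul_nonneg hG.diag_nonneg (sq_nonneg _)
  have h_diag_le : v ⬝ᵥ diagPart G *ᵥ v ≤ ‖G‖ * (v ⬝ᵥ v) :=
    (dotProduct_mulVec_self_le _ v).trans
      (mul_le_mul_of_nonneg_right (norm_diagPart_le G) (dotProduct_self_nonneg v))
  rw [offDiag, Matrix.sub_mulVec, dotProduct_sub, abs_le]
  constructor <;>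
    linarith [dotProduct_mulVec_self_le G v, dotProduct_mulVec_nonneg_of_posSemidef hG v]

theorem norm_hadamard_le_of_posSemidef (hG : G.PosSemidef) (A : Matrix (Fin d) (Fin d) ℝ) :
    ‖A ⊙ G‖ ≤ ‖A‖ * ‖G‖ := by
  obtain ⟨m, x, rfl⟩ := Matrix.posSemidef_iff_eq_sum_vecMulVec.1 hG
  set G := ∑ k, Matrix.vecMulVec (x k) (star (x k)) with h_def
  -- `A ⊙ x xᵀ = diag(x) A diag(x)`, and `diag(x)²` is the diagonal part of `x xᵀ`.
  have h_sum : A ⊙ G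
      = ∫ k, Matrix.diagonal (x k) * A * (Matrix.diagonal (x k))ᵀ ∂Measure.count := by
    ext i j
    simp only [h_def, integral_count, Matrix.hadamard_apply, Matrix.sum_apply, Finset.mul_sum,
      Matrix.vecMulVec_apply, star_trivial, Matrix.diagonal_transpose,
      Matrix.mul_diagonal, Matrix.diagonal_mul]
    exact Finset.sum_congr rfl fun k _ => by ring
  have h_diag : ∫ k, Matrix.diagonal (x k) * (Matrix.diagonal (x k))ᵀ ∂Measure.count
      = diagPart G := by
    ext i j
    simp only [h_def, integral_count, diagPart_apply, Matrix.sum_apply, Matrix.vecMulVec_apply,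
      star_trivial, Matrix.diagonal_transpose, Matrix.diagonal_mul_diagonal,
      Matrix.diagonal_apply]
    split_ifs <;> simp only [Finset.sum_const_zero]
  calc ‖A ⊙ G‖
      ≤ ‖A‖ * ‖∫ k, Matrix.diagonal (x k) * (Matrix.diagonal (x k))ᵀ ∂Measure.count‖ :=
        h_sum ▸ norm_integral_mul_mul_transpose_le .of_finite .of_finite
    _ ≤ ‖A‖ * ‖G‖ := by
        rw [h_diag]
        gcongr
        exact norm_diagPart_le _

end Parts

section LambdaMin

variable {d : ℕ} {A G : Matrix (Fin d) (Fin d) ℝ}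

theorem lambdaMin_mul_le (hA : A.IsSymm) (v : Fin d → ℝ) :
    lambdaMin A * (v ⬝ᵥ v) ≤ v ⬝ᵥ A *ᵥ v := by
  have h_herm : (A - lambdaMin A • (1 : Matrix (Fin d) (Fin d) ℝ)).IsHermitian :=
    Matrix.isHermitian_iff_isSymm.2 (hA.sub (Matrix.isSymm_one.smul _))
  have h_psd : (A - lambdaMin A • (1 : Matrix (Fin d) (Fin d) ℝ)).PosSemidef := by
    refine h_herm.posSemidef_iff_eigenvalues_nonneg.2 fun i => ?_
    have h_spectrum := h_herm.eigenvalues_mem_spectrum_real i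
    generalize h_herm.eigenvalues i = e at h_spectrum
    rw [← Algebra.algebraMap_eq_smul_one, ← spectrum.sub_singleton_eq] at h_spectrum
    obtain ⟨x, hx, y, rfl, rfl⟩ := h_spectrum
    exact sub_nonneg.2 (csInf_le A.finite_real_spectrum.bddBelow hx)
  have h_nonneg := dotProduct_mulVec_nonneg_of_posSemidef h_psd v
  simp only [Matrix.sub_mulVec, dotProduct_sub, Matrix.smul_mulVec, Matrix.one_mulVec,
    dotProduct_smul, smul_eq_mul] at h_nonneg
  linarith

theorem le_lambdaMin [Nonempty (Fin d)] (hA : A.IsSymm) {c : ℝ}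
    (h : ∀ v : Fin d → ℝ, c * (v ⬝ᵥ v) ≤ v ⬝ᵥ A *ᵥ v) : c ≤ lambdaMin A := by
  have h_herm : A.IsHermitian := Matrix.isHermitian_iff_isSymm.2 hA
  rw [lambdaMin, h_herm.spectrum_real_eq_range_eigenvalues]
  refine le_ciInf fun i => ?_
  have h_ne : (h_herm.eigenvectorBasis i).ofLp ≠ 0 := by
    simpa using h_herm.eigenvectorBasis.orthonormal.ne_zero i
  have h_eigen := h (h_herm.eigenvectorBasis i).ofLp
  rw [h_herm.mulVec_eigenvectorBasis, dotProduct_smul, smul_eq_mul] at h_eigen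
  exact le_of_mul_le_mul_right h_eigen (dotProduct_self_pos h_ne)

theorem lambdaMin_le_norm [Nonempty (Fin d)] (hA : A.IsSymm) : lambdaMin A ≤ ‖A‖ := by
  obtain ⟨i⟩ := ‹Nonempty (Fin d)›
  simpa using (lambdaMin_mul_le hA (Pi.single i 1)).trans (dotProduct_mulVec_self_le A _)

theorem norm_one_sub_smul_le [Nonempty (Fin d)] (hA : A.IsSymm) {a : ℝ} (ha : 0 ≤ a)
    (haA : a * ‖A‖ ≤ 1) : ‖1 - a • A‖ ≤ 1 - a * lambdaMin A := by
  have h_min := mul_le_mul_of_nonneg_left (lambdaMin_le_norm hA) ha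
  refine norm_le_of_abs_dotProduct_mulVec_le (Matrix.isSymm_one.sub (hA.smul a)) (by linarith)
    fun v => ?_
  have h_lower := mul_le_mul_of_nonneg_left (lambdaMin_mul_le hA v) ha
  have h_upper := mul_le_mul_of_nonneg_left (dotProduct_mulVec_self_le A v) ha
  have h_scale := mul_le_mul_of_nonneg_right haA (dotProduct_self_nonneg v)
  simp only [Matrix.sub_mulVec, Matrix.one_mulVec, Matrix.smul_mulVec, dotProduct_sub,
    dotProduct_smul, smul_eq_mul]
  rw [abs_of_nonneg (by linarith)]
  linarith

theorem mul_minDiag_mul_le_dotProduct_pPart (hG : G.PosSemidef) {p : ℝ} (hp0 : 0 ≤ p) (hp1 : p ≤ 1)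
    (v : Fin d → ℝ) : (1 - p) * minDiag G * (v ⬝ᵥ v) ≤ v ⬝ᵥ pPart p G *ᵥ v := by
  have h_diag : minDiag G * (v ⬝ᵥ v) ≤ v ⬝ᵥ diagPart G *ᵥ v := by
    rw [dotProduct_diagPart_mulVec, dotProduct, Finset.mul_sum]
    refine Finset.sum_le_sum fun i _ => ?_
    rw [← pow_two]
    gcongr
    exact ciInf_le (Set.finite_range _).bddBelow i
  have h_psd := mul_nonneg hp0 (dotProduct_mulVec_nonneg_of_posSemidef hG v)
  have h_scaled := mul_le_mul_of_nonneg_left h_diag (sub_nonneg.2 hp1)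
  simp only [pPart, Matrix.add_mulVec, Matrix.smul_mulVec, dotProduct_add, dotProduct_smul,
    smul_eq_mul]
  linarith

theorem mul_minDiag_le_lambdaMin_pPart [Nonempty (Fin d)] (hG : G.PosSemidef) {p : ℝ} (hp0 : 0 ≤ p)
    (hp1 : p ≤ 1) : (1 - p) * minDiag G ≤ lambdaMin (pPart p G) :=
  le_lambdaMin (isSymm_pPart p (isSymm_of_posSemidef hG))
    (mul_minDiag_mul_le_dotProduct_pPart hG hp0 hp1)

end LambdaMin

section Gram

variable {n d : ℕ}

theorem posSemidef_gram (X : Matrix (Fin n) (Fin d) ℝ) : (gram X).PosSemidef :=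
  Matrix.posSemidef_conjTranspose_mul_self X

theorem isSymm_gram (X : Matrix (Fin n) (Fin d) ℝ) : (gram X).IsSymm :=
  isSymm_of_posSemidef (posSemidef_gram X)

end Gram

section Resolvent

variable {E : Type*} [NormedAddCommGroup E] [NormedSpace ℝ E] [FiniteDimensional ℝ E]
  {T : Module.End ℝ E} {q : ℝ}

theorem isUnit_one_sub_of_norm_le (hq : q < 1) (hT : ∀ x, ‖T x‖ ≤ q * ‖x‖) :
    IsUnit (1 - T) := by
  rw [LinearMap.isUnit_iff_ker_eq_bot, LinearMap.ker_eq_bot']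
  intro x hx
  have h_fixed : T x = x := (sub_eq_zero.1 hx).symm
  by_contra h_ne
  have h_pos : 0 < ‖x‖ := norm_pos_iff.2 h_ne
  have h_le := hT x
  rw [h_fixed] at h_le
  nlinarith

theorem apply_inverse_one_sub_add (hq : q < 1) (hT : ∀ x, ‖T x‖ ≤ q * ‖x‖) (x : E) :
    T (Ring.inverse (1 - T) x) + x = Ring.inverse (1 - T) x := by
  have h_cancel := DFunLike.congr_fun
    (Ring.mul_inverse_cancel _ (isUnit_one_sub_of_norm_le hq hT)) x
  exact (sub_eq_iff_eq_add'.1 h_cancel).symm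

theorem norm_inverse_one_sub_apply_le (hq : q < 1) (hT : ∀ x, ‖T x‖ ≤ q * ‖x‖) (x : E) :
    ‖Ring.inverse (1 - T) x‖ ≤ ‖x‖ / (1 - q) := by
  rw [le_div_iff₀ (by linarith)]
  have h_triangle := norm_add_le (T (Ring.inverse (1 - T) x)) x
  rw [apply_inverse_one_sub_add hq hT] at h_triangle
  linarith [hT (Ring.inverse (1 - T) x)]

end Resolvent

/-! ### The affine operator is a contraction -/

section Contraction

variable {d : ℕ} {G : Matrix (Fin d) (Fin d) ℝ} {α p : ℝ}

theorem norm_hadamard_hadamard_le_of_posSemidef (hG : G.PosSemidef)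
    (A : Matrix (Fin d) (Fin d) ℝ) : ‖G ⊙ A ⊙ G‖ ≤ ‖G‖ ^ 2 * ‖A‖ := by
  rw [Matrix.hadamard_comm G A]
  calc ‖A ⊙ G ⊙ G‖ ≤ ‖A ⊙ G‖ * ‖G‖ := norm_hadamard_le_of_posSemidef hG _
    _ ≤ ‖A‖ * ‖G‖ * ‖G‖ := by gcongr; exact norm_hadamard_le_of_posSemidef hG _
    _ = _ := by ring

theorem norm_opS_bracket_le (hG : G.PosSemidef) (hp0 : 0 ≤ p) (hp1 : p ≤ 1)
    (A : Matrix (Fin d) (Fin d) ℝ) :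
    ‖pPart p (offDiag G * diagPart A * offDiag G) + offDiag G * diagPart (pPart p G * A)
      + diagPart (pPart p G * A) * offDiag G‖ ≤ 3 * ‖G‖ ^ 2 * ‖A‖ := by
  have h_off := norm_offDiag_le_of_posSemidef hG
  have h_diag : ‖diagPart (pPart p G * A)‖ ≤ ‖G‖ * ‖A‖ :=
    (norm_diagPart_le _).trans (norm_mul_le_of_le (norm_pPart_le hp0 hp1 G) le_rfl)
  have h_sandwich : ‖offDiag G * diagPart A * offDiag G‖ ≤ ‖G‖ * ‖A‖ * ‖G‖ :=
    norm_mul_le_of_le (norm_mul_le_of_le h_off (norm_diagPart_le A)) h_off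
  calc _ ≤ ‖G‖ * ‖A‖ * ‖G‖ + ‖G‖ * (‖G‖ * ‖A‖) + ‖G‖ * ‖A‖ * ‖G‖ :=
        norm_add_le_of_le (norm_add_le_of_le ((norm_pPart_le hp0 hp1 _).trans h_sandwich)
          (norm_mul_le_of_le h_off h_diag)) (norm_mul_le_of_le h_diag h_off)
    _ = _ := by ring

theorem norm_opS_zero_le (hG : G.PosSemidef) (hp0 : 0 ≤ p) (hp1 : p ≤ 1)
    (A : Matrix (Fin d) (Fin d) ℝ) :
    ‖opS α p G 0 A‖ ≤ (‖1 - (α * p) • pPart p G‖ ^ 2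
      + α ^ 2 * p * (1 - p) * (1 + 2 * p * (1 - p) + 3 * p) * ‖G‖ ^ 2) * ‖A‖ := by
  have _ := sub_nonneg.2 hp1
  have hGp := norm_pPart_le hp0 hp1 G
  have h_sandwich {P : Matrix (Fin d) (Fin d) ℝ} {c : ℝ} (hP : ‖P‖ ≤ c) :
      ‖P * A * P‖ ≤ c ^ 2 * ‖A‖ :=
    (norm_mul_le_of_le (norm_mul_le_of_le hP le_rfl) hP).trans_eq (by ring)
  have h_hadamard : ‖G ⊙ offDiag A ⊙ G‖ ≤ ‖G‖ ^ 2 * (2 * ‖A‖) :=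
    (norm_hadamard_hadamard_le_of_posSemidef hG _).trans
      (mul_le_mul_of_nonneg_left (norm_offDiag_le_two_mul A) (sq_nonneg _))
  have h_smul {c a : ℝ} {M : Matrix (Fin d) (Fin d) ℝ} (hc : 0 ≤ c) (hM : ‖M‖ ≤ a) :
      ‖c • M‖ ≤ c * a := by
    rw [norm_smul, Real.norm_of_nonneg hc]
    exact mul_le_mul_of_nonneg_left hM hc
  rw [opS, add_zero]
  calc _ ≤ ‖1 - (α * p) • pPart p G‖ ^ 2 * ‖A‖ + α ^ 2 * p * (1 - p) * (‖G‖ ^ 2 * ‖A‖)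
        + α ^ 2 * p ^ 2 * (1 - p) ^ 2 * (‖G‖ ^ 2 * (2 * ‖A‖))
        + α ^ 2 * p ^ 2 * (1 - p) * (3 * ‖G‖ ^ 2 * ‖A‖) :=
        norm_add_le_of_le (norm_add_le_of_le (norm_add_le_of_le (h_sandwich le_rfl)
          (h_smul (by positivity) ((norm_diagPart_le _).trans (h_sandwich hGp))))
          (h_smul (by positivity) h_hadamard))
          (h_smul (by positivity) (norm_opS_bracket_le hG hp0 hp1 A))
    _ = _ := by ring

theorem contraction_factor_le {l g : ℝ} (hα : 0 ≤ α) (hp0 : 0 ≤ p) (hp1 : p ≤ 1) (hl0 : 0 ≤ l)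
    (hl : l ≤ g) (h_step : 3 * α * g ^ 2 ≤ l) :
    (1 - α * p * l) ^ 2 + α ^ 2 * p * (1 - p) * (1 + 2 * p * (1 - p) + 3 * p) * g ^ 2
      ≤ 1 - α * p * l := by
  have hp1' := sub_nonneg.2 hp1
  have h_αl : 3 * (α * l) ≤ 1 := by
    rcases hl0.eq_or_lt with rfl | hl_pos
    · norm_num
    · have h_sq : 3 * α * l ^ 2 ≤ l := le_trans (by gcongr) h_step
      nlinarith
  have h_poly : (1 - p) * (1 + 2 * p * (1 - p) + 3 * p) ≤ 3 - p := by
    nlinarith [sq_nonneg (2 * p - 1), mul_nonneg (sq_nonneg p) hp1']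
  have h_noise : α * p * ((1 - p) * (1 + 2 * p * (1 - p) + 3 * p) * (α * g ^ 2))
      ≤ α * p * ((3 - p) * (l / 3)) := by
    gcongr
    · linarith
    · linarith
  have h_drift : α * p * l * (p * (3 * (α * l))) ≤ α * p * l * (p * 1) := by gcongr
  nlinarith

theorem norm_opSLin_le {l : ℝ} (hG : G.PosSemidef) (hα : 0 ≤ α) (hp0 : 0 ≤ p) (hp1 : p ≤ 1)
    (hl0 : 0 ≤ l) (hl : l ≤ ‖G‖) (h_step : 3 * α * ‖G‖ ^ 2 ≤ l)
    (h_drift : ‖1 - (α * p) • pPart p G‖ ≤ 1 - α * p * l) (B A : Matrix (Fin d) (Fin d) ℝ) :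
    ‖opSLin α p G B A‖ ≤ (1 - α * p * l) * ‖A‖ := by
  have h_linear : opSLin α p G B A = opS α p G 0 A := opS_sub_zero α p G B A
  rw [h_linear]
  calc ‖opS α p G 0 A‖ ≤ (‖1 - (α * p) • pPart p G‖ ^ 2
        + α ^ 2 * p * (1 - p) * (1 + 2 * p * (1 - p) + 3 * p) * ‖G‖ ^ 2) * ‖A‖ :=
        norm_opS_zero_le hG hp0 hp1 A
    _ ≤ ((1 - α * p * l) ^ 2
        + α ^ 2 * p * (1 - p) * (1 + 2 * p * (1 - p) + 3 * p) * ‖G‖ ^ 2) * ‖A‖ := by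
        gcongr
    _ ≤ (1 - α * p * l) * ‖A‖ := by
        gcongr
        exact contraction_factor_le hα hp0 hp1 hl0 hl h_step

end Contraction

/-! ### Moments of a dropout matrix -/

section Moment

variable {d : ℕ}

/-- Conditional probability that coordinate `a` survives dropout, given that the coordinates `i`
and `j` do. -/
def keepProb (p : ℝ) (i j a : Fin d) : ℝ := if a = i ∨ a = j then 1 else p

/-- The matrix `M` with `E[D A D B D C D] = p M_p` for a `p`-dropout matrix `D`. -/
def momentMatrix (p : ℝ) (A B C : Matrix (Fin d) (Fin d) ℝ) : Matrix (Fin d) (Fin d) ℝ :=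
  pPart p A * B * pPart p C
    + (1 - p) • (offDiag A * diagPart (B * pPart p C) + diagPart (pPart p A * B) * offDiag C)
    + (1 - p) ^ 2 • (offDiag A ⊙ Bᵀ ⊙ offDiag C)
    + (p * (1 - p)) • (offDiag A * diagPart B * offDiag C)

theorem pow_card_eq_keepProb (p : ℝ) (i j a b : Fin d) :
    p ^ ({i, j, a, b} : Finset (Fin d)).card = (if i = j then p else p ^ 2) *
      (keepProb p i j a * keepProb p i j b
        + if a = b then keepProb p i j a * (1 - keepProb p i j a) else 0) := by
  unfold keepProb
  by_cases h1 : i = j <;> by_cases h2 : i = a <;> by_cases h3 : i = b <;> by_cases h4 : j = a <;>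
    by_cases h5 : j = b <;> by_cases h6 : a = b <;>
    simp_all [Finset.card_insert_of_notMem, eq_comm] <;> ring

variable {p : ℝ} (A B C : Matrix (Fin d) (Fin d) ℝ) (i j a b : Fin d)

theorem smul_pPart_apply :
    (p • pPart p A) i j = (if i = j then p else p ^ 2) * A i j := by
  rw [Matrix.smul_apply, pPart_apply, smul_eq_mul]
  split_ifs with h
  · rw [h]
  · ring

theorem mul_keepProb_left : A i a * keepProb p i j a
    = pPart p A i a + (1 - p) * offDiag A i j * (1 : Matrix (Fin d) (Fin d) ℝ) j a := by
  simp only [keepProb, pPart_apply, offDiag_apply, Matrix.one_apply]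
  by_cases h1 : i = a <;> by_cases h2 : j = a <;> by_cases h3 : i = j <;>
    simp_all [eq_comm] <;> ring

theorem mul_keepProb_right : C b j * keepProb p i j b
    = pPart p C b j + (1 - p) * offDiag C i j * (1 : Matrix (Fin d) (Fin d) ℝ) b i := by
  simp only [keepProb, pPart_apply, offDiag_apply, Matrix.one_apply]
  by_cases h1 : i = b <;> by_cases h2 : j = b <;> by_cases h3 : i = j <;>
    simp_all [eq_comm] <;> ring

theorem mul_mul_keepProb_variance : A i a * C a j * (keepProb p i j a * (1 - keepProb p i j a))
    = p * (1 - p) * (offDiag A i a * offDiag C a j) := by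
  simp only [keepProb, offDiag_apply]
  by_cases h1 : i = a <;> by_cases h2 : a = j <;> simp_all [eq_comm]
  ring

theorem mul_mul_apply_eq_sum : (A * B * C) i j = ∑ a, ∑ b, A i a * B a b * C b j := by
  simp only [Matrix.mul_apply, Finset.sum_mul]
  exact Finset.sum_comm

theorem momentMatrix_apply : momentMatrix p A B C i j
    = ∑ a, ∑ b, A i a * B a b * C b j * (keepProb p i j a * keepProb p i j b
        + if a = b then keepProb p i j a * (1 - keepProb p i j a) else 0) := by
  set cA := (1 - p) * offDiag A i j with hcA
  set cC := (1 - p) * offDiag C i j with hcC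
  have h_term (a b : Fin d) : A i a * B a b * C b j * (keepProb p i j a * keepProb p i j b
        + if a = b then keepProb p i j a * (1 - keepProb p i j a) else 0)
      = pPart p A i a * B a b * pPart p C b j
        + cC * (pPart p A i a * B a b * (1 : Matrix (Fin d) (Fin d) ℝ) b i)
        + cA * ((1 : Matrix (Fin d) (Fin d) ℝ) j a * B a b * pPart p C b j)
        + cA * cC * ((1 : Matrix (Fin d) (Fin d) ℝ) j a * B a b
          * (1 : Matrix (Fin d) (Fin d) ℝ) b i)
        + if a = b then p * (1 - p) * (offDiag A i a * B a a * offDiag C a j) else 0 := by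
    have h_variance : A i a * B a b * C b j *
          (if a = b then keepProb p i j a * (1 - keepProb p i j a) else 0)
        = if a = b then p * (1 - p) * (offDiag A i a * B a a * offDiag C a j) else 0 := by
      split_ifs with hab
      · subst hab
        linear_combination B a a * mul_mul_keepProb_variance (p := p) A C i j a
      · ring
    rw [← h_variance]
    linear_combination B a b * (C b j * keepProb p i j b * mul_keepProb_left (p := p) A i j a
      + (pPart p A i a + cA * (1 : Matrix (Fin d) (Fin d) ℝ) j a)
        * mul_keepProb_right (p := p) C i j b)
  have h_sandwich : (offDiag A * diagPart B * offDiag C) i j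
      = ∑ a, offDiag A i a * B a a * offDiag C a j := by
    rw [Matrix.mul_apply]
    simp only [diagPart, Matrix.mul_diagonal, Matrix.diag_apply]
  simp only [h_term, Finset.sum_add_distrib, ← Finset.mul_sum, ← mul_mul_apply_eq_sum,
    Finset.sum_ite_eq, Finset.mem_univ, if_true, ← h_sandwich, mul_one, one_mul]
  simp only [momentMatrix, Matrix.add_apply, Matrix.smul_apply, Matrix.hadamard_apply,
    Matrix.transpose_apply, diagPart, Matrix.mul_diagonal, Matrix.diagonal_mul,
    Matrix.diag_apply, smul_eq_mul, hcA, hcC]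
  ring

theorem momentMatrix_one_right (A B : Matrix (Fin d) (Fin d) ℝ) :
    momentMatrix p A B 1 = pPart p A * B + (1 - p) • (offDiag A * diagPart B) := by
  simp only [momentMatrix, pPart_one, offDiag_one, mul_one, mul_zero, add_zero,
    Matrix.hadamard_zero, smul_zero]

theorem momentMatrix_one_left (B C : Matrix (Fin d) (Fin d) ℝ) :
    momentMatrix p 1 B C = B * pPart p C + (1 - p) • (diagPart B * offDiag C) := by
  simp only [momentMatrix, pPart_one, offDiag_one, one_mul, zero_mul, zero_add, add_zero,
    Matrix.zero_hadamard, smul_zero]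

end Moment

namespace IsDropoutMatrix

variable {Ω : Type*} [MeasurableSpace Ω] {μ : Measure Ω} {d : ℕ} {p : unitInterval}
  {D : Ω → Matrix (Fin d) (Fin d) ℝ}

theorem eq_diagonal (hD : IsDropoutMatrix μ p D) (ω : Ω) :
    D ω = Matrix.diagonal (D ω).diag :=
  (hD.isDiag ω).diagonal_diag.symm

theorem isSymm (hD : IsDropoutMatrix μ p D) (ω : Ω) : (D ω).IsSymm :=
  (hD.isDiag ω).isSymm

theorem ae_zero_or_one (hD : IsDropoutMatrix μ p D) :
    ∀ᵐ ω ∂μ, ∀ i, D ω i i = 0 ∨ D ω i i = 1 := by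
  rw [ae_all_iff]
  intro i
  have h_meas : MeasurableSet {x : ℝ | x = 0 ∨ x = 1} :=
    (measurableSet_singleton 0).union (measurableSet_singleton 1)
  have h_law : ∀ᵐ x ∂(μ.map fun ω => D ω i i), x = 0 ∨ x = 1 := by
    rw [hD.law i, ae_iff]
    exact bernoulliMeasure_apply_of_notMem_of_notMem p h_meas.compl (by simp) (by simp)
  exact ae_of_ae_map (hD.measurable i).aemeasurable h_law

theorem ae_mul_self (hD : IsDropoutMatrix μ p D) : ∀ᵐ ω ∂μ, D ω * D ω = D ω := by
  filter_upwards [hD.ae_zero_or_one] with ω h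
  rw [hD.eq_diagonal ω, Matrix.diagonal_mul_diagonal]
  congr 1
  funext i
  rcases h i with h | h <;> simp [h]

theorem ae_norm_le_one (hD : IsDropoutMatrix μ p D) : ∀ᵐ ω ∂μ, ‖D ω‖ ≤ 1 := by
  filter_upwards [hD.ae_zero_or_one] with ω h
  rw [hD.eq_diagonal ω, Matrix.l2_opNorm_diagonal, pi_norm_le_iff_of_nonneg zero_le_one]
  intro i
  rcases h i with h | h <;> simp [h]

theorem memLp_top (hD : IsDropoutMatrix μ p D) : MemLp D ⊤ μ := by
  have h_meas : Measurable fun ω => (D ω).diag := measurable_pi_lambda _ hD.measurable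
  have h_strongly : AEStronglyMeasurable D μ := by
    rw [funext hD.eq_diagonal]
    exact (Continuous.matrix_diagonal continuous_id).comp_aestronglyMeasurable
      h_meas.aestronglyMeasurable
  exact memLp_top_of_bound h_strongly 1 hD.ae_norm_le_one

theorem integral_diag (hD : IsDropoutMatrix μ p D) (i : Fin d) : ∫ ω, D ω i i ∂μ = p := by
  have h_map := integral_map (hD.measurable i).aemeasurable (μ := μ) (f := id)
    aestronglyMeasurable_id
  rw [hD.law i, integral_bernoulliMeasure] at h_map
  simpa using h_map.symm

theorem integral_prod_diag (hD : IsDropoutMatrix μ p D) (s : Finset (Fin d)) :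
    ∫ ω, ∏ i ∈ s, D ω i i ∂μ = (p : ℝ) ^ s.card := by
  have h_prod := (hD.indep.precomp (g := fun i : s => (i : Fin d)) Subtype.val_injective)
    |>.integral_fun_prod_eq_prod_integral fun i => (hD.measurable i).aestronglyMeasurable
  simp only [hD.integral_diag, Finset.prod_const, Finset.card_univ, Fintype.card_coe] at h_prod
  rw [← h_prod]
  exact integral_congr_ae (ae_of_all _ fun ω => (Finset.prod_coe_sort s fun i => D ω i i).symm)

theorem integral_mul_diag (hD : IsDropoutMatrix μ p D) (i j a b : Fin d) :
    ∫ ω, D ω i i * D ω j j * D ω a a * D ω b b ∂μ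
      = p ^ ({i, j, a, b} : Finset (Fin d)).card := by
  rw [← hD.integral_prod_diag]
  refine integral_congr_ae ?_
  filter_upwards [hD.ae_zero_or_one] with ω h
  -- The entries are idempotent, so repeated indices do not change the product.
  have h_insert (k : Fin d) (s : Finset (Fin d)) :
      ∏ l ∈ insert k s, D ω l l = D ω k k * ∏ l ∈ s, D ω l l := by
    by_cases hk : k ∈ s
    · rw [Finset.insert_eq_of_mem hk, ← Finset.mul_prod_erase s _ hk]
      rcases h k with h | h <;> simp [h]
    · exact Finset.prod_insert hk
  rw [h_insert, h_insert, h_insert, Finset.prod_singleton]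
  ring

theorem integrable_mul_diag (hD : IsDropoutMatrix μ p D) (i j a b : Fin d) :
    Integrable (fun ω => D ω i i * D ω j j * D ω a a * D ω b b) μ := by
  have := hD.indep.isProbabilityMeasure
  have h_entry (k : Fin d) : MemLp (fun ω => D ω k k) ⊤ μ := memLp_matrix_apply hD.memLp_top k k
  exact ((h_entry b).mul (r := ⊤) ((h_entry a).mul (r := ⊤)
    ((h_entry j).mul (r := ⊤) (h_entry i)))).integrable le_top

variable (A B C : Matrix (Fin d) (Fin d) ℝ)

theorem memLp_top_conj (hD : IsDropoutMatrix μ p D) :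
    MemLp (fun ω => D ω * A * D ω) ⊤ μ := by
  have := hD.indep.isProbabilityMeasure
  exact memLp_top_matrix_mul (memLp_top_matrix_mul hD.memLp_top (memLp_top_const A)) hD.memLp_top

theorem integral_conj_mul_conj (hD : IsDropoutMatrix μ p D) :
    ∫ ω, D ω * A * D ω * B * (D ω * C * D ω) ∂μ
      = (p : ℝ) • pPart p (momentMatrix p A B C) := by
  have := hD.indep.isProbabilityMeasure
  have h_integrable : Integrable (fun ω => D ω * A * D ω * B * (D ω * C * D ω)) μ :=
    (memLp_top_matrix_mul (memLp_top_matrix_mul (hD.memLp_top_conj A) (memLp_top_const B))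
      (hD.memLp_top_conj C)).integrable le_top
  ext i j
  have h_entry (ω : Ω) : (D ω * A * D ω * B * (D ω * C * D ω)) i j
      = ∑ a, ∑ b, A i a * B a b * C b j * (D ω i i * D ω j j * D ω a a * D ω b b) := by
    rw [hD.eq_diagonal ω]
    simp only [mul_mul_apply_eq_sum _ B, Matrix.mul_diagonal, Matrix.diagonal_mul,
      Matrix.diag_apply, Matrix.diagonal_apply_eq]
    exact Finset.sum_congr rfl fun a _ => Finset.sum_congr rfl fun b _ => by ring
  have h_term (a b : Fin d) := (hD.integrable_mul_diag i j a b).const_mul (A i a * B a b * C b j)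
  rw [integral_matrix_apply h_integrable, smul_pPart_apply, momentMatrix_apply, Finset.mul_sum]
  simp_rw [h_entry]
  rw [integral_finsetSum _ fun a _ => integrable_finsetSum _ fun b _ => h_term a b]
  refine Finset.sum_congr rfl fun a _ => ?_
  rw [integral_finsetSum _ fun b _ => h_term a b, Finset.mul_sum]
  refine Finset.sum_congr rfl fun b _ => ?_
  rw [integral_const_mul, hD.integral_mul_diag, pow_card_eq_keepProb]
  ring

theorem integral_conj_mul (hD : IsDropoutMatrix μ p D) :
    ∫ ω, D ω * A * D ω * B * D ω ∂μ
      = (p : ℝ) • pPart p (pPart p A * B + (1 - p : ℝ) • (offDiag A * diagPart B)) := by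
  rw [← momentMatrix_one_right, ← hD.integral_conj_mul_conj]
  refine integral_congr_ae ?_
  filter_upwards [hD.ae_mul_self] with ω h
  rw [mul_one, h]

theorem integral_mul_conj (hD : IsDropoutMatrix μ p D) :
    ∫ ω, D ω * B * (D ω * C * D ω) ∂μ
      = (p : ℝ) • pPart p (B * pPart p C + (1 - p : ℝ) • (diagPart B * offDiag C)) := by
  rw [← momentMatrix_one_left, ← hD.integral_conj_mul_conj]
  refine integral_congr_ae ?_
  filter_upwards [hD.ae_mul_self] with ω h
  rw [mul_one, h]

theorem integral_conj (hD : IsDropoutMatrix μ p D) :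
    ∫ ω, D ω * B * D ω ∂μ = (p : ℝ) • pPart p B := by
  have h_one : pPart p 1 * B + (1 - p : ℝ) • (offDiag 1 * diagPart B) = B := by
    rw [pPart_one, offDiag_one, one_mul, zero_mul, smul_zero, add_zero]
  rw [← h_one, ← hD.integral_conj_mul, h_one]
  refine integral_congr_ae ?_
  filter_upwards [hD.ae_mul_self] with ω h
  rw [mul_one, h]

theorem integral_eq (hD : IsDropoutMatrix μ p D) :
    ∫ ω, D ω ∂μ = (p : ℝ) • (1 : Matrix (Fin d) (Fin d) ℝ) := by
  rw [← pPart_one (p := p), ← hD.integral_conj]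
  refine integral_congr_ae ?_
  filter_upwards [hD.ae_mul_self] with ω h
  rw [mul_one, h]

end IsDropoutMatrix

/-! ### The random coefficients of the error recursion -/

section Step

variable {d : ℕ}

/-- The random linear part `I - α D G D` of one step of the error recursion. -/
def errorStep (α : ℝ) (G D : Matrix (Fin d) (Fin d) ℝ) : Matrix (Fin d) (Fin d) ℝ :=
  1 - α • (D * G * D)

/-- The coefficient `α D (G - Diag(G)) (p I - D)` with which `β̃` enters one step of the error
recursion; its mean over a `p`-dropout matrix `D` is zero. -/
def noiseStep (α p : ℝ) (G D : Matrix (Fin d) (Fin d) ℝ) : Matrix (Fin d) (Fin d) ℝ :=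
  α • (D * offDiag G * (p • (1 : Matrix (Fin d) (Fin d) ℝ) - D))

variable {α p : ℝ} {G A B D : Matrix (Fin d) (Fin d) ℝ}

theorem isSymm_errorStep (hG : G.IsSymm) (hD : D.IsSymm) : (errorStep α G D).IsSymm := by
  simp only [errorStep, Matrix.IsSymm, Matrix.transpose_sub, Matrix.transpose_one,
    Matrix.transpose_smul, Matrix.transpose_mul, hG.eq, hD.eq, mul_assoc]

theorem transpose_noiseStep (hG : G.IsSymm) (hD : D.IsSymm) :
    (noiseStep α p G D)ᵀ
      = α • ((p • (1 : Matrix (Fin d) (Fin d) ℝ) - D) * offDiag G * D) := by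
  simp only [noiseStep, Matrix.transpose_smul, Matrix.transpose_mul, Matrix.transpose_sub,
    Matrix.transpose_one, (isSymm_offDiag hG).eq, hD.eq, mul_assoc]

theorem errorStep_conj (hG : G.IsSymm) (hD : D.IsSymm) :
    errorStep α G D * A * (errorStep α G D)ᵀ
      = A - α • (D * G * D * A + A * (D * G * D)) + α ^ 2 • (D * G * D * A * (D * G * D)) := by
  rw [(isSymm_errorStep hG hD).eq, errorStep]
  simp only [sub_mul, mul_sub, one_mul, mul_one, smul_mul_assoc, mul_smul_comm]
  module

theorem noiseStep_conj (hG : G.IsSymm) (hD : D.IsSymm) :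
    noiseStep α p G D * B * (noiseStep α p G D)ᵀ
      = α ^ 2 • (p ^ 2 • (D * (offDiag G * B * offDiag G) * D)
        - p • (D * offDiag G * D * (B * offDiag G) * D)
        - p • (D * (offDiag G * B) * (D * offDiag G * D))
        + D * offDiag G * D * B * (D * offDiag G * D)) := by
  rw [transpose_noiseStep hG hD, noiseStep]
  simp only [sub_mul, mul_sub, one_mul, mul_one, smul_mul_assoc, mul_smul_comm, mul_assoc]
  module

theorem noiseStep_eq : noiseStep α p G D = α • (p • (D * offDiag G) - D * offDiag G * D) := by
  rw [noiseStep, mul_sub, mul_smul_comm, mul_one]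

theorem diagPart_mul_comm_of_isSymm (hA : A.IsSymm) (hB : B.IsSymm) :
    diagPart (A * B) = diagPart (B * A) := by
  rw [diagPart, ← Matrix.diag_transpose, Matrix.transpose_mul, hA.eq, hB.eq, diagPart]

theorem diagPart_offDiag_mul_diagonal (x : Fin d → ℝ) :
    diagPart (offDiag A * Matrix.diagonal x) = 0 := by
  ext i j
  simp only [diagPart_apply, Matrix.mul_diagonal, offDiag_apply, if_true, zero_mul, ite_self,
    Matrix.zero_apply]

theorem diagPart_diagonal_mul_offDiag (x : Fin d → ℝ) :
    diagPart (Matrix.diagonal x * offDiag A) = 0 := by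
  ext i j
  simp only [diagPart_apply, Matrix.diagonal_mul, offDiag_apply, if_true, mul_zero, ite_self,
    Matrix.zero_apply]

theorem diagPart_hadamard_offDiag : diagPart (A ⊙ offDiag B) = 0 := by
  ext i j
  simp only [diagPart_apply, Matrix.hadamard_apply, offDiag_apply, if_true, mul_zero, ite_self,
    Matrix.zero_apply]

theorem offDiag_hadamard_hadamard_offDiag :
    offDiag A ⊙ G ⊙ offDiag B = A ⊙ offDiag G ⊙ B := by
  ext i j
  simp only [Matrix.hadamard_apply, offDiag_apply]
  split_ifs <;> ring

theorem smul_pPart_momentMatrix (hG : G.IsSymm) (hA : A.IsSymm) :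
    p • pPart p (momentMatrix p G A G)
      = p ^ 2 • (pPart p G * A * pPart p G)
        + (p * (1 - p)) • diagPart (pPart p G * A * pPart p G)
        + (p ^ 2 * (1 - p) ^ 2) • (G ⊙ offDiag A ⊙ G)
        + (p ^ 2 * (1 - p)) • (pPart p (offDiag G * diagPart A * offDiag G)
          + offDiag G * diagPart (pPart p G * A) + diagPart (pPart p G * A) * offDiag G) := by
  have h_hadamard : pPart p (offDiag G ⊙ A ⊙ offDiag G) = p • (G ⊙ offDiag A ⊙ G) := by
    rw [pPart_eq_smul diagPart_hadamard_offDiag, offDiag_hadamard_hadamard_offDiag]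
  have h_right : pPart p (offDiag G * diagPart (pPart p G * A))
      = p • (offDiag G * diagPart (pPart p G * A)) :=
    pPart_eq_smul (diagPart_offDiag_mul_diagonal _)
  have h_left : pPart p (diagPart (pPart p G * A) * offDiag G)
      = p • (diagPart (pPart p G * A) * offDiag G) :=
    pPart_eq_smul (diagPart_diagonal_mul_offDiag _)
  rw [momentMatrix, diagPart_mul_comm_of_isSymm hA (isSymm_pPart p hG), hA.eq]
  simp only [pPart_add, pPart_smul, h_hadamard, h_left, h_right]
  rw [show pPart p (pPart p G * A * pPart p G) = p • (pPart p G * A * pPart p G)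
    + (1 - p) • diagPart (pPart p G * A * pPart p G) from rfl]
  module

theorem smul_pPart_momentMatrix_offDiag (hB : B.IsSymm) :
    p ^ 2 • p • pPart p (offDiag G * B * offDiag G)
      - p • p • pPart p (pPart p (offDiag G) * (B * offDiag G)
          + (1 - p) • (offDiag (offDiag G) * diagPart (B * offDiag G)))
      - p • p • pPart p (offDiag G * B * pPart p (offDiag G)
          + (1 - p) • (diagPart (offDiag G * B) * offDiag (offDiag G)))
      + p • pPart p (momentMatrix p (offDiag G) B (offDiag G))
      = (p ^ 2 * (1 - p) ^ 2) • (G ⊙ offDiag B ⊙ G)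
        + (p ^ 2 * (1 - p)) • pPart p (offDiag G * diagPart B * offDiag G) := by
  have h_hadamard : pPart p (offDiag G ⊙ B ⊙ offDiag G) = p • (G ⊙ offDiag B ⊙ G) := by
    rw [pPart_eq_smul diagPart_hadamard_offDiag, offDiag_hadamard_hadamard_offDiag]
  simp only [momentMatrix, pPart_offDiag, offDiag_offDiag, hB.eq, pPart_add, pPart_smul,
    diagPart_smul, mul_smul_comm, smul_mul_assoc, h_hadamard, mul_assoc]
  module

end Step

namespace IsDropoutMatrix

variable {Ω : Type*} [MeasurableSpace Ω] {μ : Measure Ω} {d : ℕ} {p : unitInterval}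
  {D : Ω → Matrix (Fin d) (Fin d) ℝ} {G A B : Matrix (Fin d) (Fin d) ℝ}

theorem memLp_top_errorStep (hD : IsDropoutMatrix μ p D) (α : ℝ)
    (G : Matrix (Fin d) (Fin d) ℝ) : MemLp (fun ω => errorStep α G (D ω)) ⊤ μ := by
  have := hD.indep.isProbabilityMeasure
  exact (memLp_top_const _).sub ((hD.memLp_top_conj G).const_smul α)

theorem memLp_top_noiseStep (hD : IsDropoutMatrix μ p D) (α : ℝ)
    (G : Matrix (Fin d) (Fin d) ℝ) : MemLp (fun ω => noiseStep α p G (D ω)) ⊤ μ := by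
  have := hD.indep.isProbabilityMeasure
  exact (memLp_top_matrix_mul (memLp_top_matrix_mul hD.memLp_top (memLp_top_const _))
    ((memLp_top_const _).sub hD.memLp_top)).const_smul α

theorem integral_errorStep (hD : IsDropoutMatrix μ p D) (α : ℝ)
    (G : Matrix (Fin d) (Fin d) ℝ) :
    ∫ ω, errorStep α G (D ω) ∂μ = 1 - (α * p) • pPart p G := by
  have := hD.indep.isProbabilityMeasure
  have h_int := ((hD.memLp_top_conj G).integrable le_top).fun_smul α
  simp only [errorStep]
  rw [integral_sub (integrable_const _) h_int, integral_smul, hD.integral_conj, smul_smul,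
    integral_const, probReal_univ, one_smul]

theorem integral_noiseStep (hD : IsDropoutMatrix μ p D) (α : ℝ)
    (G : Matrix (Fin d) (Fin d) ℝ) :
    ∫ ω, noiseStep α p G (D ω) ∂μ = 0 := by
  have := hD.indep.isProbabilityMeasure
  have h_int : Integrable (fun ω => D ω * offDiag G) μ :=
    (memLp_top_matrix_mul hD.memLp_top (memLp_top_const _)).integrable le_top
  have h_mean : ∫ ω, D ω * offDiag G ∂μ = (p : ℝ) • offDiag G := by
    rw [integral_mul_const_of_integrable (hD.memLp_top.integrable le_top), hD.integral_eq,
      smul_one_mul]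
  simp only [noiseStep_eq]
  rw [integral_smul, integral_sub (h_int.fun_smul (p : ℝ))
    ((hD.memLp_top_conj (offDiag G)).integrable le_top), integral_smul, h_mean, hD.integral_conj,
    pPart_offDiag, sub_self, smul_zero]

theorem integral_errorStep_conj (hD : IsDropoutMatrix μ p D) (hG : G.IsSymm) (hA : A.IsSymm)
    (α : ℝ) :
    ∫ ω, errorStep α G (D ω) * A * (errorStep α G (D ω))ᵀ ∂μ = opS α p G 0 A := by
  have := hD.indep.isProbabilityMeasure
  have h_conj := hD.memLp_top_conj G
  have h_left : Integrable (fun ω => D ω * G * D ω * A) μ :=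
    (memLp_top_matrix_mul h_conj (memLp_top_const A)).integrable le_top
  have h_right : Integrable (fun ω => A * (D ω * G * D ω)) μ :=
    (memLp_top_matrix_mul (memLp_top_const A) h_conj).integrable le_top
  have h_both : Integrable (fun ω => D ω * G * D ω * A * (D ω * G * D ω)) μ :=
    (memLp_top_matrix_mul (memLp_top_matrix_mul h_conj (memLp_top_const A)) h_conj).integrable
      le_top
  have h_linear : Integrable
      (fun ω => A - α • (D ω * G * D ω * A + A * (D ω * G * D ω))) μ :=
    (integrable_const A).sub ((h_left.add h_right).smul α)
  simp only [errorStep_conj hG (hD.isSymm _)]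
  rw [integral_add h_linear (h_both.fun_smul (α ^ 2)),
    integral_sub (integrable_const A) ((h_left.fun_add h_right).fun_smul α), integral_smul,
    integral_smul, integral_add h_left h_right,
    integral_mul_const_of_integrable (h_conj.integrable le_top),
    integral_const_mul_of_integrable (h_conj.integrable le_top), hD.integral_conj,
    hD.integral_conj_mul_conj, smul_pPart_momentMatrix hG hA, opS, integral_const,
    probReal_univ, add_zero]
  simp only [sub_mul, mul_sub, one_mul, mul_one, smul_mul_assoc, mul_smul_comm]
  module

theorem integral_noiseStep_conj (hD : IsDropoutMatrix μ p D) (hG : G.IsSymm) (hB : B.IsSymm)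
    (α : ℝ) :
    ∫ ω, noiseStep α p G (D ω) * B * (noiseStep α p G (D ω))ᵀ ∂μ = opS α p G B 0 := by
  have := hD.indep.isProbabilityMeasure
  have h_sandwich : Integrable
      (fun ω => (p : ℝ) ^ 2 • (D ω * (offDiag G * B * offDiag G) * D ω)) μ :=
    ((hD.memLp_top_conj _).integrable le_top).fun_smul _
  have h_left : Integrable
      (fun ω => (p : ℝ) • (D ω * offDiag G * D ω * (B * offDiag G) * D ω)) μ :=
    ((memLp_top_matrix_mul (memLp_top_matrix_mul (hD.memLp_top_conj _) (memLp_top_const _))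
      hD.memLp_top).integrable le_top).fun_smul _
  have h_right : Integrable
      (fun ω => (p : ℝ) • (D ω * (offDiag G * B) * (D ω * offDiag G * D ω))) μ :=
    ((memLp_top_matrix_mul (memLp_top_matrix_mul hD.memLp_top (memLp_top_const _))
      (hD.memLp_top_conj _)).integrable le_top).fun_smul _
  have h_both : Integrable
      (fun ω => D ω * offDiag G * D ω * B * (D ω * offDiag G * D ω)) μ :=
    (memLp_top_matrix_mul (memLp_top_matrix_mul (hD.memLp_top_conj _) (memLp_top_const B))
      (hD.memLp_top_conj _)).integrable le_top
  have h_diff : Integrable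
      (fun ω => (p : ℝ) ^ 2 • (D ω * (offDiag G * B * offDiag G) * D ω)
        - (p : ℝ) • (D ω * offDiag G * D ω * (B * offDiag G) * D ω)) μ := h_sandwich.sub h_left
  have h_cross : Integrable
      (fun ω => (p : ℝ) ^ 2 • (D ω * (offDiag G * B * offDiag G) * D ω)
        - (p : ℝ) • (D ω * offDiag G * D ω * (B * offDiag G) * D ω)
        - (p : ℝ) • (D ω * (offDiag G * B) * (D ω * offDiag G * D ω))) μ := h_diff.sub h_right
  simp only [noiseStep_conj hG (hD.isSymm _)]
  rw [integral_smul, integral_add h_cross h_both, integral_sub h_diff h_right,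
    integral_sub h_sandwich h_left, integral_smul, integral_smul, integral_smul,
    hD.integral_conj, hD.integral_conj_mul, hD.integral_mul_conj, hD.integral_conj_mul_conj,
    smul_pPart_momentMatrix_offDiag hB, opS_zero]
  module

/-- `S(0) = E[N B Nᵀ]` is at most `‖B‖ ‖E[N Nᵀ]‖`, and only the diagonal term of `S(0)` survives at
`B = I`. Bounding the two terms of `S(0)` separately would lose a factor `2 - p`. -/
theorem norm_opS_apply_zero_le (hD : IsDropoutMatrix μ p D) (hG : G.PosSemidef) (hB : B.IsSymm)
    (α : ℝ) :
    ‖opS α p G B 0‖ ≤ α ^ 2 * p ^ 2 * (1 - p) * ‖G‖ ^ 2 * ‖B‖ := by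
  have := hD.indep.isProbabilityMeasure
  have hG_symm := isSymm_of_posSemidef hG
  have h_noise := hD.memLp_top_noiseStep α G
  have h_le := norm_integral_mul_mul_transpose_le (A := B)
    ((memLp_top_matrix_mul (memLp_top_matrix_mul h_noise (memLp_top_const B))
      (memLp_matrix_transpose h_noise)).integrable le_top)
    ((memLp_top_matrix_mul h_noise (memLp_matrix_transpose h_noise)).integrable le_top)
  have h_one := hD.integral_noiseStep_conj hG_symm Matrix.isSymm_one α
  simp only [mul_one, opS_zero, offDiag_one, diagPart_one, Matrix.hadamard_zero,
    Matrix.zero_hadamard, smul_zero, zero_add] at h_one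
  have h_coeff : 0 ≤ α ^ 2 * (p : ℝ) ^ 2 * (1 - p) :=
    mul_nonneg (by positivity) (sub_nonneg.2 p.2.2)
  rw [hD.integral_noiseStep_conj hG_symm hB, h_one, norm_smul,
    Real.norm_of_nonneg h_coeff] at h_le
  have h_off := norm_offDiag_le_of_posSemidef hG
  have h_sq : ‖pPart p (offDiag G * offDiag G)‖ ≤ ‖G‖ * ‖G‖ :=
    (norm_pPart_le p.2.1 p.2.2 _).trans (norm_mul_le_of_le h_off h_off)
  calc ‖opS α p G B 0‖
      ≤ ‖B‖ * (α ^ 2 * p ^ 2 * (1 - p) * ‖pPart p (offDiag G * offDiag G)‖) := h_le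
    _ ≤ ‖B‖ * (α ^ 2 * p ^ 2 * (1 - p) * (‖G‖ * ‖G‖)) := by gcongr
    _ = α ^ 2 * p ^ 2 * (1 - p) * ‖G‖ ^ 2 * ‖B‖ := by ring

theorem ae_norm_errorStep_le (hD : IsDropoutMatrix μ p D) {α : ℝ} (hα : 0 ≤ α)
    (G : Matrix (Fin d) (Fin d) ℝ) : ∀ᵐ ω ∂μ, ‖errorStep α G (D ω)‖ ≤ 1 + α * ‖G‖ := by
  filter_upwards [hD.ae_norm_le_one] with ω h
  have h_one : ‖(1 : Matrix (Fin d) (Fin d) ℝ)‖ ≤ 1 := by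
    rw [← Matrix.diagonal_one, Matrix.l2_opNorm_diagonal]
    exact pi_norm_const_le 1 |>.trans norm_one.le
  have h_conj : ‖D ω * G * D ω‖ ≤ ‖G‖ := by
    simpa only [one_mul, mul_one] using norm_mul_le_of_le (norm_mul_le_of_le h le_rfl) h
  refine norm_sub_le_of_le h_one ?_
  rw [norm_smul, Real.norm_of_nonneg hα]
  gcongr

theorem ae_norm_noiseStep_le (hD : IsDropoutMatrix μ p D) {α : ℝ} (hα : 0 ≤ α)
    (hG : G.PosSemidef) : ∀ᵐ ω ∂μ, ‖noiseStep α p G (D ω)‖ ≤ α * ‖G‖ := by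
  filter_upwards [hD.ae_norm_le_one, hD.ae_zero_or_one] with ω h_norm h
  have h_centered : ‖(p : ℝ) • (1 : Matrix (Fin d) (Fin d) ℝ) - D ω‖ ≤ 1 := by
    rw [hD.eq_diagonal ω, Matrix.smul_one_eq_diagonal, Matrix.diagonal_sub,
      Matrix.l2_opNorm_diagonal, pi_norm_le_iff_of_nonneg zero_le_one]
    intro i
    rw [Real.norm_eq_abs, abs_le, Matrix.diag_apply]
    rcases h i with h | h <;> rw [h] <;> constructor <;> linarith [p.2.1, p.2.2]
  have h_prod : ‖D ω * offDiag G * ((p : ℝ) • 1 - D ω)‖ ≤ ‖G‖ := by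
    simpa only [one_mul, mul_one] using norm_mul_le_of_le
      (norm_mul_le_of_le h_norm (norm_offDiag_le_of_posSemidef hG)) h_centered
  rw [noiseStep, norm_smul, Real.norm_of_nonneg hα]
  gcongr

end IsDropoutMatrix

section GeometricSum

variable {q : ℝ}

theorem sum_range_le_of_le_mul_add {a : ℕ → ℝ} {r : ℝ} (ha : ∀ k, 0 ≤ a k) (hq0 : 0 ≤ q)
    (hq : q < 1) (hr : 0 ≤ r) (h : ∀ k, a (k + 1) ≤ q * a k + r * q ^ k) (k : ℕ) :
    ∑ l ∈ Finset.range k, a l ≤ a 0 / (1 - q) + r / (1 - q) ^ 2 := by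
  have hs : 0 < 1 - q := sub_pos.2 hq
  have h_potential : ∑ l ∈ Finset.range k, a l + (a k / (1 - q) + r * q ^ k / (1 - q) ^ 2)
      ≤ a 0 / (1 - q) + r / (1 - q) ^ 2 := by
    induction k with
    | zero => simp
    | succ k ih =>
      have h_step : a (k + 1) / (1 - q) ≤ (q * a k + r * q ^ k) / (1 - q) := by
        gcongr
        exact h k
      have h_balance : a k + ((q * a k + r * q ^ k) / (1 - q) + r * q ^ (k + 1) / (1 - q) ^ 2)
          = a k / (1 - q) + r * q ^ k / (1 - q) ^ 2 := by
        field_simp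
        ring
      rw [Finset.sum_range_succ]
      linarith
  have h_nonneg : 0 ≤ a k / (1 - q) + r * q ^ k / (1 - q) ^ 2 :=
    add_nonneg (div_nonneg (ha k) hs.le) (by positivity)
  linarith

theorem sum_Icc_ite_pow_sub_le (hq0 : 0 ≤ q) (hq : q < 1) (k m : ℕ) :
    ∑ l ∈ Finset.Icc 1 k, (if m ≤ l then q ^ (l - m) else 0) ≤ 1 / (1 - q) := by
  have h_subset : (Finset.Icc 1 k).filter (m ≤ ·) ⊆ Finset.Ico m (k + 1) := by
    intro l hl
    simp only [Finset.mem_filter, Finset.mem_Icc, Finset.mem_Ico] at hl ⊢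
    omega
  calc ∑ l ∈ Finset.Icc 1 k, (if m ≤ l then q ^ (l - m) else 0)
      = ∑ l ∈ Finset.Icc 1 k with m ≤ l, q ^ (l - m) := (Finset.sum_filter _ _).symm
    _ ≤ ∑ l ∈ Finset.Ico m (k + 1), q ^ (l - m) :=
        Finset.sum_le_sum_of_subset_of_nonneg h_subset fun l _ _ => by positivity
    _ = ∑ j ∈ Finset.range (k + 1 - m), q ^ j := by
        simp only [Finset.sum_Ico_eq_sum_range, Nat.add_sub_cancel_left]
    _ ≤ ∑' j, q ^ j := (summable_geometric_of_lt_one hq0 hq).sum_le_tsum _ fun j _ => by positivity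
    _ = 1 / (1 - q) := by rw [tsum_geometric_of_lt_one hq0 hq, one_div]

theorem sum_sum_le_of_geometric {f : ℕ → ℕ → ℝ} {a : ℕ → ℝ} (hq0 : 0 ≤ q) (hq : q < 1)
    (ha : ∀ l, 0 ≤ a l) (hf : ∀ l m, m ≤ l → f l m ≤ q ^ (l - m) * a m)
    (h_symm : ∀ l m, f l m = f m l) (k : ℕ) :
    ∑ l ∈ Finset.Icc 1 k, ∑ m ∈ Finset.Icc 1 k, f l m
      ≤ 2 / (1 - q) * ∑ m ∈ Finset.Icc 1 k, a m := by
  set w : ℕ → ℕ → ℝ := fun l m => (if m ≤ l then q ^ (l - m) else 0) * a m with hw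
  have hw_nonneg (l m : ℕ) : 0 ≤ w l m :=
    mul_nonneg (by split_ifs <;> positivity) (ha m)
  have hfw {l m : ℕ} (hm : m ≤ l) : f l m ≤ w l m := by
    simpa only [hw, if_pos hm] using hf l m hm
  have h_split (l m : ℕ) : f l m ≤ w l m + w m l := by
    rcases le_total m l with hm | hm
    · exact (hfw hm).trans (le_add_of_nonneg_right (hw_nonneg m l))
    · exact h_symm l m ▸ (hfw hm).trans (le_add_of_nonneg_left (hw_nonneg l m))
  have h_column : ∑ m ∈ Finset.Icc 1 k, ∑ l ∈ Finset.Icc 1 k, w l m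
      ≤ 1 / (1 - q) * ∑ m ∈ Finset.Icc 1 k, a m := by
    simp only [hw, ← Finset.sum_mul, Finset.mul_sum]
    gcongr with m
    · exact ha m
    · exact sum_Icc_ite_pow_sub_le hq0 hq k m
  calc ∑ l ∈ Finset.Icc 1 k, ∑ m ∈ Finset.Icc 1 k, f l m
      ≤ ∑ l ∈ Finset.Icc 1 k, ∑ m ∈ Finset.Icc 1 k, (w l m + w m l) := by
        gcongr with l _ m
        exact h_split l m
    _ = 2 * ∑ m ∈ Finset.Icc 1 k, ∑ l ∈ Finset.Icc 1 k, w l m := by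
        simp only [Finset.sum_add_distrib, two_mul]
        congr 1
        exact Finset.sum_comm
    _ ≤ 2 * (1 / (1 - q) * ∑ m ∈ Finset.Icc 1 k, a m) := by gcongr
    _ = 2 / (1 - q) * ∑ m ∈ Finset.Icc 1 k, a m := by ring

end GeometricSum

/-! ### Affine recursions with random coefficients -/

section AffineRecursion

variable {Ω : Type*} [MeasurableSpace Ω] {μ : Measure Ω} {d m : ℕ}

/-- A square integrable process `Z_{k+1} = M_k Z_k + N_k b` whose bounded random coefficients
`(M_k, N_k)` are independent of the past of the process. -/
structure IsAffineRecursion (μ : Measure Ω) (M : ℕ → Ω → Matrix (Fin d) (Fin d) ℝ)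
    (N : ℕ → Ω → Matrix (Fin d) (Fin m) ℝ) (b : Ω → Fin m → ℝ) (Z : ℕ → Ω → Fin d → ℝ) :
    Prop where
  memLp_linear : ∀ k, MemLp (M k) ⊤ μ
  memLp_noise : ∀ k, MemLp (N k) ⊤ μ
  squareIntegrable_input : SquareIntegrable μ b
  squareIntegrable_zero : SquareIntegrable μ (Z 0)
  step : ∀ k, Z (k + 1) =ᵐ[μ] fun ω => M k ω *ᵥ Z k ω + N k ω *ᵥ b ω
  indep : ∀ k, ∀ l ≤ k,
    IndepFun (fun ω => (M k ω, N k ω)) (fun ω => (Z k ω, b ω, Z l ω)) μ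

/-- An affine recursion with centered noise coefficients whose first two moments contract at
rate `q`: the linear part acts on second moments by `Φ`, the noise contributes `S₀` to them, and
`r` bounds the correlation between both parts. -/
structure IsContractiveRecursion (μ : Measure Ω) (M : ℕ → Ω → Matrix (Fin d) (Fin d) ℝ)
    (N : ℕ → Ω → Matrix (Fin d) (Fin m) ℝ) (b : Ω → Fin m → ℝ) (Z : ℕ → Ω → Fin d → ℝ)
    (Φ : Module.End ℝ (Matrix (Fin d) (Fin d) ℝ)) (S₀ : Matrix (Fin d) (Fin d) ℝ)
    (q r : ℝ) : Prop extends IsAffineRecursion μ M N b Z where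
  rate_lt_one : q < 1
  norm_integral_linear_le : ∀ k, ‖∫ ω, M k ω ∂μ‖ ≤ q
  integral_noise : ∀ k, ∫ ω, N k ω ∂μ = 0
  integral_linear_conj : ∀ k A, A.IsSymm → ∫ ω, M k ω * A * (M k ω)ᵀ ∂μ = Φ A
  norm_apply_le : ∀ A, ‖Φ A‖ ≤ q * ‖A‖
  integral_noise_conj : ∀ k, ∫ ω, N k ω * expOuter μ b b * (N k ω)ᵀ ∂μ = S₀
  ae_norm_mul_norm_le : ∀ k, ∀ᵐ ω ∂μ, ‖M k ω‖ * ‖N k ω‖ ≤ r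

namespace IsAffineRecursion

variable {M : ℕ → Ω → Matrix (Fin d) (Fin d) ℝ} {N : ℕ → Ω → Matrix (Fin d) (Fin m) ℝ}
  {b : Ω → Fin m → ℝ} {Z : ℕ → Ω → Fin d → ℝ}

theorem squareIntegrable (h : IsAffineRecursion μ M N b Z) (k : ℕ) :
    SquareIntegrable μ (Z k) := by
  induction k with
  | zero => exact h.squareIntegrable_zero
  | succ k ih =>
    intro i
    refine (memLp_congr_ae ?_).2 (((ih.mulVec (h.memLp_linear k)).add
      (h.squareIntegrable_input.mulVec (h.memLp_noise k))) i)
    filter_upwards [h.step k] with ω h_step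
    rw [h_step]

variable [IsProbabilityMeasure μ]

theorem expOuter_succ_left (h : IsAffineRecursion μ M N b Z) {k l : ℕ} {V : Ω → Fin l → ℝ}
    (h_mean : ∫ ω, N k ω ∂μ = 0) (hV : SquareIntegrable μ V)
    (hindep : IndepFun (fun ω => (M k ω, N k ω)) (fun ω => (Z k ω, b ω, V ω)) μ) :
    expOuter μ (Z (k + 1)) V = (∫ ω, M k ω ∂μ) * expOuter μ (Z k) V := by
  have hZ := h.squareIntegrable k
  have hb := h.squareIntegrable_input
  have h_linear : IndepFun (M k) (fun ω => (Z k ω, V ω)) μ := hindep.comp measurable_fst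
    (measurable_fst.prodMk (measurable_snd.comp measurable_snd))
  have h_noise : IndepFun (N k) (fun ω => (b ω, V ω)) μ :=
    hindep.comp measurable_snd measurable_snd
  rw [expOuter_congr_ae (h.step k) (EventuallyEq.refl _ V),
    expOuter_add_left (hZ.mulVec (h.memLp_linear k)) (hb.mulVec (h.memLp_noise k)) hV,
    expOuter_mulVec_left (h.memLp_linear k) hZ hV h_linear,
    expOuter_mulVec_left (h.memLp_noise k) hb hV h_noise, h_mean, Matrix.zero_mul, add_zero]

theorem expOuter_succ_self (h : IsAffineRecursion μ M N b Z) (k : ℕ) :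
    expOuter μ (Z (k + 1)) (Z (k + 1))
      = (∫ ω, M k ω * expOuter μ (Z k) (Z k) * (M k ω)ᵀ ∂μ)
        + (∫ ω, N k ω * expOuter μ b b * (N k ω)ᵀ ∂μ)
        + ((∫ ω, M k ω * expOuter μ (Z k) b * (N k ω)ᵀ ∂μ)
          + (∫ ω, M k ω * expOuter μ (Z k) b * (N k ω)ᵀ ∂μ)ᵀ) := by
  have hZ := h.squareIntegrable k
  have hb := h.squareIntegrable_input
  have hM := h.memLp_linear k
  have hN := h.memLp_noise k
  have hMZ := hZ.mulVec hM
  have hNb := hb.mulVec hN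
  have h_indep := h.indep k k le_rfl
  have h_coeff : IndepFun (fun ω => (M k ω, N k ω)) (fun ω => (Z k ω, b ω)) μ :=
    h_indep.comp measurable_id (measurable_fst.prodMk (measurable_fst.comp measurable_snd))
  have h_linear : IndepFun (fun ω => (M k ω, M k ω)) (fun ω => (Z k ω, Z k ω)) μ :=
    h_coeff.comp (measurable_fst.prodMk measurable_fst) (measurable_fst.prodMk measurable_fst)
  have h_noise : IndepFun (fun ω => (N k ω, N k ω)) (fun ω => (b ω, b ω)) μ :=
    h_coeff.comp (measurable_snd.prodMk measurable_snd) (measurable_snd.prodMk measurable_snd)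
  rw [expOuter_congr_ae (h.step k) (h.step k), expOuter_add_left hMZ hNb (hMZ.add hNb),
    expOuter_add_right hMZ hMZ hNb, expOuter_add_right hNb hMZ hNb,
    expOuter_mulVec_mulVec hM hM hZ hZ h_linear, expOuter_mulVec_mulVec hN hN hb hb h_noise,
    ← transpose_expOuter (fun ω => M k ω *ᵥ Z k ω),
    expOuter_mulVec_mulVec hM hN hZ hb h_coeff]
  abel

end IsAffineRecursion

namespace IsContractiveRecursion

variable {M : ℕ → Ω → Matrix (Fin d) (Fin d) ℝ} {N : ℕ → Ω → Matrix (Fin d) (Fin m) ℝ}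
  {b : Ω → Fin m → ℝ} {Z : ℕ → Ω → Fin d → ℝ} {Φ : Module.End ℝ (Matrix (Fin d) (Fin d) ℝ)}
  {S₀ : Matrix (Fin d) (Fin d) ℝ} {q r : ℝ}

theorem rate_nonneg (h : IsContractiveRecursion μ M N b Z Φ S₀ q r) : 0 ≤ q :=
  (norm_nonneg _).trans (h.norm_integral_linear_le 0)

variable [IsProbabilityMeasure μ]

theorem norm_expOuter_le (h : IsContractiveRecursion μ M N b Z Φ S₀ q r) {k l : ℕ}
    (hl : l ≤ k) :
    ‖expOuter μ (Z k) (Z l)‖ ≤ q ^ (k - l) * ‖expOuter μ (Z l) (Z l)‖ := by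
  induction k, hl using Nat.le_induction with
  | base => simp
  | succ k hl ih =>
    rw [h.expOuter_succ_left (h.integral_noise k) (h.squareIntegrable l) (h.indep k l hl),
      Nat.succ_sub hl, pow_succ', mul_assoc]
    exact norm_mul_le_of_le (h.norm_integral_linear_le k) ih

theorem norm_expOuter_input_le (h : IsContractiveRecursion μ M N b Z Φ S₀ q r) (k : ℕ) :
    ‖expOuter μ (Z k) b‖ ≤ q ^ k * ‖expOuter μ (Z 0) b‖ := by
  induction k with
  | zero => simp
  | succ k ih =>
    have h_indep : IndepFun (fun ω => (M k ω, N k ω)) (fun ω => (Z k ω, b ω, b ω)) μ :=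
      (h.indep k k le_rfl).comp measurable_id (measurable_fst.prodMk
        ((measurable_fst.comp measurable_snd).prodMk (measurable_fst.comp measurable_snd)))
    rw [h.expOuter_succ_left (h.integral_noise k) h.squareIntegrable_input h_indep, pow_succ',
      mul_assoc]
    exact (Matrix.l2_opNorm_mul _ _).trans
      (mul_le_mul (h.norm_integral_linear_le k) ih (norm_nonneg _) h.rate_nonneg)

theorem norm_integral_cross_le (h : IsContractiveRecursion μ M N b Z Φ S₀ q r)
    (k : ℕ) (C : Matrix (Fin d) (Fin m) ℝ) :
    ‖∫ ω, M k ω * C * (N k ω)ᵀ ∂μ‖ ≤ r * ‖C‖ := by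
  refine (norm_integral_le_of_norm_le_const (C := r * ‖C‖) ?_).trans_eq ?_
  · filter_upwards [h.ae_norm_mul_norm_le k] with ω h_norm
    calc ‖M k ω * C * (N k ω)ᵀ‖ ≤ ‖M k ω‖ * ‖C‖ * ‖N k ω‖ := by
          rw [← norm_transpose (N k ω)]
          exact (Matrix.l2_opNorm_mul _ _).trans
            (mul_le_mul_of_nonneg_right (Matrix.l2_opNorm_mul _ _) (norm_nonneg _))
      _ = ‖M k ω‖ * ‖N k ω‖ * ‖C‖ := by ring
      _ ≤ r * ‖C‖ := by gcongr
  · rw [probReal_univ, mul_one]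

theorem norm_expOuter_succ_sub_le (h : IsContractiveRecursion μ M N b Z Φ S₀ q r) (k : ℕ) :
    ‖expOuter μ (Z (k + 1)) (Z (k + 1)) - (Φ (expOuter μ (Z k) (Z k)) + S₀)‖
      ≤ 2 * r * ‖expOuter μ (Z k) b‖ := by
  have h_cross := h.norm_integral_cross_le k (expOuter μ (Z k) b)
  rw [h.expOuter_succ_self, h.integral_linear_conj k _ (isSymm_expOuter _),
    h.integral_noise_conj, add_sub_cancel_left]
  refine (norm_add_le _ _).trans ?_
  rw [norm_transpose]
  linarith

theorem sum_norm_expOuter_sub_le (h : IsContractiveRecursion μ M N b Z Φ S₀ q r) (k : ℕ) :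
    ∑ l ∈ Finset.Icc 1 k, ‖expOuter μ (Z l) (Z l) - Ring.inverse (1 - Φ) S₀‖
      ≤ ‖expOuter μ (Z 0) (Z 0) - Ring.inverse (1 - Φ) S₀‖ / (1 - q)
        + 2 * r * ‖expOuter μ (Z 0) b‖ / (1 - q) ^ 2 := by
  set L := Ring.inverse (1 - Φ) S₀
  have h_fixed : Φ L + S₀ = L := apply_inverse_one_sub_add h.rate_lt_one h.norm_apply_le S₀
  have hr : 0 ≤ r := by
    obtain ⟨ω, h_norm⟩ := (h.ae_norm_mul_norm_le 0).exists
    exact le_trans (by positivity) h_norm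
  have h_subset : Finset.Icc 1 k ⊆ Finset.range (k + 1) := fun l hl =>
    Finset.mem_range.2 (Nat.lt_succ_of_le (Finset.mem_Icc.1 hl).2)
  refine (Finset.sum_le_sum_of_subset_of_nonneg h_subset fun _ _ _ => norm_nonneg _).trans
    (sum_range_le_of_le_mul_add (a := fun l => ‖expOuter μ (Z l) (Z l) - L‖)
      (fun _ => norm_nonneg _) h.rate_nonneg h.rate_lt_one (by positivity) (fun l => ?_) (k + 1))
  have h_decompose : expOuter μ (Z (l + 1)) (Z (l + 1)) - L
      = Φ (expOuter μ (Z l) (Z l) - L)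
        + (expOuter μ (Z (l + 1)) (Z (l + 1)) - (Φ (expOuter μ (Z l) (Z l)) + S₀)) := by
    rw [map_sub]
    nth_rw 1 [← h_fixed]
    abel
  calc ‖expOuter μ (Z (l + 1)) (Z (l + 1)) - L‖
      ≤ q * ‖expOuter μ (Z l) (Z l) - L‖ + 2 * r * ‖expOuter μ (Z l) b‖ := by
        rw [h_decompose]
        exact norm_add_le_of_le (h.norm_apply_le _) (h.norm_expOuter_succ_sub_le l)
    _ ≤ q * ‖expOuter μ (Z l) (Z l) - L‖ + 2 * r * (q ^ l * ‖expOuter μ (Z 0) b‖) := by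
        gcongr
        exact h.norm_expOuter_input_le l
    _ = q * ‖expOuter μ (Z l) (Z l) - L‖ + 2 * r * ‖expOuter μ (Z 0) b‖ * q ^ l := by ring

theorem sum_norm_expOuter_le (h : IsContractiveRecursion μ M N b Z Φ S₀ q r) (k : ℕ) :
    ∑ l ∈ Finset.Icc 1 k, ‖expOuter μ (Z l) (Z l)‖
      ≤ ‖expOuter μ (Z 0) (Z 0) - Ring.inverse (1 - Φ) S₀‖ / (1 - q)
        + 2 * r * ‖expOuter μ (Z 0) b‖ / (1 - q) ^ 2 + k * (‖S₀‖ / (1 - q)) := by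
  have h_limit := norm_inverse_one_sub_apply_le h.rate_lt_one h.norm_apply_le S₀
  calc ∑ l ∈ Finset.Icc 1 k, ‖expOuter μ (Z l) (Z l)‖
      ≤ ∑ l ∈ Finset.Icc 1 k,
          (‖expOuter μ (Z l) (Z l) - Ring.inverse (1 - Φ) S₀‖ + ‖S₀‖ / (1 - q)) := by
        gcongr with l
        exact norm_le_norm_sub_add _ _ |>.trans (by gcongr)
    _ = ∑ l ∈ Finset.Icc 1 k, ‖expOuter μ (Z l) (Z l) - Ring.inverse (1 - Φ) S₀‖
          + k * (‖S₀‖ / (1 - q)) := by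
        rw [Finset.sum_add_distrib, Finset.sum_const, Nat.card_Icc, nsmul_eq_mul,
          Nat.add_sub_cancel]
    _ ≤ _ := by gcongr; exact h.sum_norm_expOuter_sub_le k

theorem norm_expOuter_average_le (h : IsContractiveRecursion μ M N b Z Φ S₀ q r) {k : ℕ}
    (hk : 1 ≤ k) :
    ‖expOuter μ (fun ω => (k : ℝ)⁻¹ • ∑ l ∈ Finset.Icc 1 k, Z l ω)
        (fun ω => (k : ℝ)⁻¹ • ∑ l ∈ Finset.Icc 1 k, Z l ω)‖
      ≤ 2 * ‖S₀‖ / (k * (1 - q) ^ 2)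
        + 2 * (‖expOuter μ (Z 0) (Z 0) - Ring.inverse (1 - Φ) S₀‖ / (1 - q) ^ 2
          + 2 * r * ‖expOuter μ (Z 0) b‖ / (1 - q) ^ 3) / k ^ 2 := by
  have hs : 0 < 1 - q := sub_pos.2 h.rate_lt_one
  have _ : (0 : ℝ) < k := by exact_mod_cast hk
  have h_double := sum_sum_le_of_geometric (f := fun l m => ‖expOuter μ (Z l) (Z m)‖)
    (a := fun m => ‖expOuter μ (Z m) (Z m)‖) h.rate_nonneg h.rate_lt_one
    (fun _ => norm_nonneg _) (fun _ _ hm => h.norm_expOuter_le hm)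
    (fun l m => by rw [← transpose_expOuter, norm_transpose]) k
  calc ‖expOuter μ (fun ω => (k : ℝ)⁻¹ • ∑ l ∈ Finset.Icc 1 k, Z l ω)
        (fun ω => (k : ℝ)⁻¹ • ∑ l ∈ Finset.Icc 1 k, Z l ω)‖
      = (k : ℝ)⁻¹ ^ 2
          * ‖∑ l ∈ Finset.Icc 1 k, ∑ m ∈ Finset.Icc 1 k, expOuter μ (Z l) (Z m)‖ := by
        rw [expOuter_smul_sum h.squareIntegrable, norm_smul, Real.norm_of_nonneg (by positivity)]
    _ ≤ (k : ℝ)⁻¹ ^ 2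
          * ∑ l ∈ Finset.Icc 1 k, ∑ m ∈ Finset.Icc 1 k, ‖expOuter μ (Z l) (Z m)‖ := by
        gcongr
        exact (norm_sum_le _ _).trans (Finset.sum_le_sum fun l _ => norm_sum_le _ _)
    _ ≤ (k : ℝ)⁻¹ ^ 2 * (2 / (1 - q) * ∑ l ∈ Finset.Icc 1 k, ‖expOuter μ (Z l) (Z l)‖) := by
        gcongr
    _ ≤ (k : ℝ)⁻¹ ^ 2 * (2 / (1 - q)
          * (‖expOuter μ (Z 0) (Z 0) - Ring.inverse (1 - Φ) S₀‖ / (1 - q)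
            + 2 * r * ‖expOuter μ (Z 0) b‖ / (1 - q) ^ 2 + k * (‖S₀‖ / (1 - q)))) := by
        gcongr
        exact h.sum_norm_expOuter_le k
    _ = _ := by
        field_simp
        ring

end IsContractiveRecursion

end AffineRecursion

section StepSize

variable {d : ℕ} {A G : Matrix (Fin d) (Fin d) ℝ} {p : unitInterval} {α : ℝ}

theorem nonempty_of_lambdaMin_pos (hA : 0 < lambdaMin A) : Nonempty (Fin d) := by
  by_contra h_empty
  rw [not_nonempty_iff] at h_empty
  rw [lambdaMin, spectrum.of_subsingleton, Real.sInf_empty] at hA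
  exact lt_irrefl _ hA

theorem lambdaMin_pos_of_lt_div (hα : 0 < α) (h : α < lambdaMin A / (3 * ‖G‖ ^ 2)) :
    0 < lambdaMin A :=
  pos_of_mul_pos_left (div_eq_mul_inv (lambdaMin A) _ ▸ hα.trans h) (by positivity)

theorem three_mul_sq_le_of_lt_div (hα : 0 < α) (h : α < lambdaMin A / (3 * ‖G‖ ^ 2)) :
    3 * α * ‖G‖ ^ 2 ≤ lambdaMin A := by
  have h_le := mul_le_of_le_div₀ (lambdaMin_pos_of_lt_div hα h).le (by positivity) h.le
  linarith

theorem lambdaMin_pPart_le_norm (hG : G.IsSymm) (hl : 0 < lambdaMin (pPart p G)) :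
    lambdaMin (pPart p G) ≤ ‖G‖ := by
  have := nonempty_of_lambdaMin_pos hl
  exact (lambdaMin_le_norm (isSymm_pPart p hG)).trans (norm_pPart_le p.2.1 p.2.2 G)

theorem lambdaMin_pPart_le_minDiag [Nonempty (Fin d)] (hG : G.IsSymm) (p : ℝ) :
    lambdaMin (pPart p G) ≤ minDiag G := by
  refine le_ciInf fun i => ?_
  simpa [pPart_apply] using lambdaMin_mul_le (isSymm_pPart p hG) (Pi.single i 1)

theorem mul_norm_le_one_of_step (hG : G.IsSymm) (hα : 0 ≤ α) (hl : 0 < lambdaMin (pPart p G))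
    (h_step : 3 * α * ‖G‖ ^ 2 ≤ lambdaMin (pPart p G)) : α * ‖G‖ ≤ 1 := by
  have h_norm := lambdaMin_pPart_le_norm hG hl
  have h_pos : 0 < ‖G‖ := hl.trans_le h_norm
  have : 0 ≤ α * ‖G‖ := by positivity
  refine le_of_mul_le_mul_right ?_ h_pos
  nlinarith

theorem norm_drift_le (hG : G.IsSymm) (hα : 0 ≤ α) (hl : 0 < lambdaMin (pPart p G))
    (h_step : 3 * α * ‖G‖ ^ 2 ≤ lambdaMin (pPart p G)) :
    ‖1 - (α * p) • pPart p G‖ ≤ 1 - α * p * lambdaMin (pPart p G) := by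
  have := nonempty_of_lambdaMin_pos hl
  have h_coeff : 0 ≤ α * p := mul_nonneg hα p.2.1
  refine norm_one_sub_smul_le (isSymm_pPart p hG) h_coeff ?_
  calc α * p * ‖pPart p G‖ ≤ α * 1 * ‖G‖ := by
        gcongr
        · exact p.2.2
        · exact norm_pPart_le p.2.1 p.2.2 G
    _ ≤ 1 := by
        rw [mul_one]
        exact mul_norm_le_one_of_step hG hα hl h_step

theorem mul_mul_lambdaMin_pPart_le_one (hG : G.IsSymm) (hα : 0 ≤ α)
    (hl : 0 < lambdaMin (pPart p G)) (h_step : 3 * α * ‖G‖ ^ 2 ≤ lambdaMin (pPart p G)) :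
    α * p * lambdaMin (pPart p G) ≤ 1 :=
  sub_nonneg.1 ((norm_nonneg _).trans (norm_drift_le hG hα hl h_step))

end StepSize

/-! ### The error of gradient descent as an affine recursion -/

section ErrorRecursion

variable {Ω : Type*} [MeasurableSpace Ω] {μ : Measure Ω} {n d : ℕ}

theorem pPart_gram_mulVec_betaTilde {p : ℝ} {X : Matrix (Fin n) (Fin d) ℝ}
    (hl : 0 < lambdaMin (pPart p (gram X))) (y : Fin n → ℝ) :
    pPart p (gram X) *ᵥ betaTilde p X y = Xᵀ *ᵥ y := by
  have h_unit : IsUnit (pPart p (gram X)) := isUnit_of_coercive hl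
    (lambdaMin_mul_le (isSymm_pPart p (isSymm_gram X)))
  rw [betaTilde, Matrix.mulVec_mulVec,
    Matrix.mul_nonsing_inv _ ((Matrix.isUnit_iff_isUnit_det _).1 h_unit), Matrix.one_mulVec]

theorem squareIntegrable_betaTilde [IsFiniteMeasure μ] {Y : Ω → Fin n → ℝ}
    (hY : SquareIntegrable μ Y) (p : ℝ) (X : Matrix (Fin n) (Fin d) ℝ) :
    SquareIntegrable μ fun ω => betaTilde p X (Y ω) :=
  (hY.mulVec (memLp_top_const Xᵀ)).mulVec (memLp_top_const (pPart p (gram X))⁻¹)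

theorem diagonal_mul_pPart_sub {x : Fin d → ℝ} (hx : ∀ i, x i = 0 ∨ x i = 1) (p : ℝ)
    (G : Matrix (Fin d) (Fin d) ℝ) :
    Matrix.diagonal x * (pPart p G - G * Matrix.diagonal x)
      = Matrix.diagonal x * offDiag G *
        (p • (1 : Matrix (Fin d) (Fin d) ℝ) - Matrix.diagonal x) := by
  rw [Matrix.smul_one_eq_diagonal, Matrix.diagonal_sub]
  ext i a
  simp only [Matrix.diagonal_mul, Matrix.mul_diagonal, Matrix.sub_apply, pPart_apply, offDiag_apply]
  split_ifs with h
  · subst h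
    rcases hx i with h | h <;> rw [h] <;> ring
  · ring

theorem gradient_step_sub_eq {x : Fin d → ℝ} (hx : ∀ i, x i = 0 ∨ x i = 1) (α p : ℝ)
    {X : Matrix (Fin n) (Fin d) ℝ} {y : Fin n → ℝ} (β : Fin d → ℝ) {b : Fin d → ℝ}
    (hb : pPart p (gram X) *ᵥ b = Xᵀ *ᵥ y) :
    β + α • (Matrix.diagonal x *ᵥ (Xᵀ *ᵥ (y - X *ᵥ (Matrix.diagonal x *ᵥ β)))) - b
      = errorStep α (gram X) (Matrix.diagonal x) *ᵥ (β - b)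
        + noiseStep α p (gram X) (Matrix.diagonal x) *ᵥ b := by
  rw [noiseStep, ← diagonal_mul_pPart_sub hx, errorStep]
  simp only [Matrix.mulVec_sub, Matrix.sub_mulVec, Matrix.smul_mulVec, Matrix.one_mulVec,
    mul_sub, smul_sub, ← hb, Matrix.mulVec_mulVec, gram, Matrix.mul_assoc]
  abel

theorem indepFun_prodMk_of_indepFun {S T U : Type*} [MeasurableSpace S] [MeasurableSpace T]
    [MeasurableSpace U] [IsProbabilityMeasure μ] {f : Ω → S} {g : Ω → T} {h : Ω → U}
    (hf : Measurable f) (hg : Measurable g) (hh : Measurable h)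
    (hfg : IndepFun f g μ) (hfgh : IndepFun (fun ω => (f ω, g ω)) h μ) :
    IndepFun (fun ω => (h ω, f ω)) g μ := by
  have hfh : IndepFun f h μ := hfgh.comp measurable_fst measurable_id
  have := Measure.isProbabilityMeasure_map (μ := μ) ((hh.prodMk hf).prodMk hg).aemeasurable
  rw [indepFun_iff_map_prod_eq_prod_map_map (hh.prodMk hf).aemeasurable hg.aemeasurable,
    Measure.ext_prod₃_iff']
  intro s t u hs ht hu
  have h_triple : (fun ω => ((h ω, f ω), g ω)) ⁻¹' ((s ×ˢ t) ×ˢ u)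
      = (fun ω => (f ω, g ω)) ⁻¹' (t ×ˢ u) ∩ h ⁻¹' s := by
    rw [Set.mk_preimage_prod, Set.mk_preimage_prod, Set.mk_preimage_prod]
    tauto_set
  rw [Measure.map_apply ((hh.prodMk hf).prodMk hg) ((hs.prod ht).prod hu), Measure.prod_prod,
    Measure.map_apply (hh.prodMk hf) (hs.prod ht), Measure.map_apply hg hu, h_triple,
    hfgh.measure_inter_preimage_eq_mul _ _ (ht.prod hu) hs, Set.mk_preimage_prod,
    Set.mk_preimage_prod, Set.inter_comm (h ⁻¹' s),
    hfg.measure_inter_preimage_eq_mul _ _ ht hu, hfh.measure_inter_preimage_eq_mul _ _ ht hs]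
  exact mul_right_comm _ _ _

/-- The data, the initialization and the diagonals of the dropout matrices used before step `k`:
everything the first `k` iterates depend on. -/
def history (D : ℕ → Ω → Matrix (Fin d) (Fin d) ℝ) (Y : Ω → Fin n → ℝ) (β₀ : Ω → Fin d → ℝ)
    (k : ℕ) (ω : Ω) : ((Fin n → ℝ) × (Fin d → ℝ)) × (Finset.range k → Fin d → ℝ) :=
  ((Y ω, β₀ ω), fun j => (D j ω).diag)

theorem measurable_gradient_step (α : ℝ) (X : Matrix (Fin n) (Fin d) ℝ) :
    Measurable fun z : (Fin d → ℝ) × (Fin d → ℝ) × (Fin n → ℝ) =>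
      z.1 + α • (Matrix.diagonal z.2.1 *ᵥ
        (Xᵀ *ᵥ (z.2.2 - X *ᵥ (Matrix.diagonal z.2.1 *ᵥ z.1)))) :=
  Continuous.measurable (by fun_prop)

theorem measurable_betaTilde (p : ℝ) (X : Matrix (Fin n) (Fin d) ℝ) :
    Measurable (betaTilde p X) :=
  (Continuous.matrix_mulVec continuous_const
    (Continuous.matrix_mulVec continuous_const continuous_id)).measurable

theorem exists_iterate_eq_comp_history {Ω : Type*} {D : ℕ → Ω → Matrix (Fin d) (Fin d) ℝ}
    (hD : ∀ k ω, (D k ω).IsDiag) (α : ℝ) (X : Matrix (Fin n) (Fin d) ℝ) (Y : Ω → Fin n → ℝ)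
    (β₀ : Ω → Fin d → ℝ) {k l : ℕ} (hl : l ≤ k) :
    ∃ φ : ((Fin n → ℝ) × (Fin d → ℝ)) × (Finset.range k → Fin d → ℝ) → Fin d → ℝ,
      Measurable φ ∧ ∀ ω, iterate α X D Y β₀ l ω = φ (history D Y β₀ k ω) := by
  induction l with
  | zero => exact ⟨fun h => h.1.2, measurable_snd.comp measurable_fst, fun ω => rfl⟩
  | succ l ih =>
    obtain ⟨φ, hφ, h_iterate⟩ := ih (Nat.le_of_succ_le hl)
    have h_mem : l ∈ Finset.range k := Finset.mem_range.2 hl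
    refine ⟨_, (measurable_gradient_step α X).comp (hφ.prodMk
      (((measurable_pi_apply (⟨l, h_mem⟩ : Finset.range k)).comp measurable_snd).prodMk
        (measurable_fst.comp measurable_fst))), fun ω => ?_⟩
    simp only [iterate, Function.comp_apply, h_iterate]
    simp only [history, (hD l ω).diagonal_diag]

variable [IsProbabilityMeasure μ] {D : ℕ → Ω → Matrix (Fin d) (Fin d) ℝ} {Y : Ω → Fin n → ℝ}
  {β₀ : Ω → Fin d → ℝ}

theorem indepFun_diag_history (hD : ∀ k, Measurable fun ω => (D k ω).diag) (hY : Measurable Y)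
    (hβ₀ : Measurable β₀) (hD_indep : iIndepFun (fun k ω => (D k ω).diag) μ)
    (hD_data : IndepFun (fun ω k => (D k ω).diag) (fun ω => (Y ω, β₀ ω)) μ) (k : ℕ) :
    IndepFun (fun ω => (D k ω).diag) (history D Y β₀ k) μ := by
  have h_past_meas : Measurable fun ω (j : Finset.range k) => (D j ω).diag :=
    measurable_pi_lambda _ fun j => hD j
  have h_past :
      IndepFun (fun ω (j : Finset.range k) => (D j ω).diag) (fun ω => (D k ω).diag) μ :=
    (hD_indep.indepFun_finset (Finset.range k) {k} (by simp) hD).comp measurable_id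
      (measurable_pi_apply (⟨k, by simp⟩ : ({k} : Finset ℕ)))
  have h_data : IndepFun (fun ω => ((fun j : Finset.range k => (D j ω).diag), (D k ω).diag))
      (fun ω => (Y ω, β₀ ω)) μ :=
    hD_data.comp (φ := fun x : ℕ → Fin d → ℝ => ((fun j : Finset.range k => x j), x k))
      ((measurable_pi_lambda _ fun j : Finset.range k => measurable_pi_apply (j : ℕ)).prodMk
        (measurable_pi_apply k)) measurable_id
  exact (indepFun_prodMk_of_indepFun h_past_meas (hD k) (hY.prodMk hβ₀) h_past h_data).symm

theorem measurable_errorStep_noiseStep (α p : ℝ) (G : Matrix (Fin d) (Fin d) ℝ) :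
    Measurable fun x : Fin d → ℝ =>
      (errorStep α G (Matrix.diagonal x), noiseStep α p G (Matrix.diagonal x)) := by
  have h_error : Continuous fun x : Fin d → ℝ => errorStep α G (Matrix.diagonal x) := by
    unfold errorStep
    fun_prop
  have h_noise : Continuous fun x : Fin d → ℝ => noiseStep α p G (Matrix.diagonal x) := by
    unfold noiseStep
    fun_prop
  refine Measurable.prodMk ?_ ?_ <;>
    refine measurable_pi_lambda _ fun i => measurable_pi_lambda _ fun j => ?_
  · exact (h_error.matrix_elem i j).measurable
  · exact (h_noise.matrix_elem i j).measurable

theorem indepFun_step_iterate {p : unitInterval} (hD : ∀ k, IsDropoutMatrix μ p (D k))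
    (hD_indep : iIndepFun (fun k ω => (D k ω).diag) μ) (hY : Measurable Y) (hβ₀ : Measurable β₀)
    (hD_data : IndepFun (fun ω k => (D k ω).diag) (fun ω => (Y ω, β₀ ω)) μ)
    (α : ℝ) (X : Matrix (Fin n) (Fin d) ℝ) {k l : ℕ} (hl : l ≤ k) :
    IndepFun (fun ω => (errorStep α (gram X) (D k ω), noiseStep α p (gram X) (D k ω)))
      (fun ω => (iterate α X D Y β₀ k ω - betaTilde p X (Y ω), betaTilde p X (Y ω),
        iterate α X D Y β₀ l ω - betaTilde p X (Y ω))) μ := by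
  obtain ⟨φ, hφ, h_now⟩ :=
    exists_iterate_eq_comp_history (fun k => (hD k).isDiag) α X Y β₀ (le_refl k)
  obtain ⟨ψ, hψ, h_past⟩ :=
    exists_iterate_eq_comp_history (fun k => (hD k).isDiag) α X Y β₀ hl
  have h_target : Measurable fun z : ((Fin n → ℝ) × (Fin d → ℝ)) × (Finset.range k → Fin d → ℝ) =>
      betaTilde p X z.1.1 :=
    (measurable_betaTilde p X).comp (measurable_fst.comp measurable_fst)
  have h_diag (k : ℕ) : Measurable fun ω => (D k ω).diag :=
    measurable_pi_lambda _ (hD k).measurable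
  have h_indep := (indepFun_diag_history h_diag hY hβ₀ hD_indep hD_data k).comp
    (measurable_errorStep_noiseStep α p (gram X))
    ((hφ.sub h_target).prodMk (h_target.prodMk (hψ.sub h_target)))
  refine h_indep.congr (ae_of_all _ fun ω => ?_) (ae_of_all _ fun ω => ?_)
  · simp only [Function.comp_apply, ← (hD k).eq_diagonal]
  · simp only [Function.comp_apply, Pi.sub_apply, ← h_now, ← h_past]
    rfl

theorem isAffineRecursion_iterate {p : unitInterval} {X : Matrix (Fin n) (Fin d) ℝ}
    (hl : 0 < lambdaMin (pPart p (gram X))) (hD : ∀ k, IsDropoutMatrix μ p (D k))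
    (hD_indep : iIndepFun (fun k ω => (D k ω).diag) μ)
    (hY : Measurable Y) (hY_sq : SquareIntegrable μ Y)
    (hβ₀ : Measurable β₀) (hβ₀_sq : SquareIntegrable μ β₀)
    (hD_data : IndepFun (fun ω k => (D k ω).diag) (fun ω => (Y ω, β₀ ω)) μ) (α : ℝ) :
    IsAffineRecursion μ (fun k ω => errorStep α (gram X) (D k ω))
      (fun k ω => noiseStep α p (gram X) (D k ω)) (fun ω => betaTilde p X (Y ω))
      (fun k ω => iterate α X D Y β₀ k ω - betaTilde p X (Y ω)) where
  memLp_linear k := (hD k).memLp_top_errorStep α (gram X)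
  memLp_noise k := (hD k).memLp_top_noiseStep α (gram X)
  squareIntegrable_input := squareIntegrable_betaTilde hY_sq p X
  squareIntegrable_zero := hβ₀_sq.sub (squareIntegrable_betaTilde hY_sq p X)
  step k := by
    filter_upwards [(hD k).ae_zero_or_one] with ω hω
    have h_step := gradient_step_sub_eq (x := (D k ω).diag) hω α p (iterate α X D Y β₀ k ω)
      (pPart_gram_mulVec_betaTilde hl (Y ω))
    rwa [← (hD k).eq_diagonal ω] at h_step
  indep k l hl := indepFun_step_iterate hD hD_indep hY hβ₀ hD_data α X hl

theorem isContractiveRecursion_iterate {p : unitInterval} {X : Matrix (Fin n) (Fin d) ℝ}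
    {α : ℝ} (hα : 0 < α) (hp0 : 0 < p) (hl : 0 < lambdaMin (pPart p (gram X)))
    (h_step : 3 * α * ‖gram X‖ ^ 2 ≤ lambdaMin (pPart p (gram X)))
    (hD : ∀ k, IsDropoutMatrix μ p (D k)) (hD_indep : iIndepFun (fun k ω => (D k ω).diag) μ)
    (hY : Measurable Y) (hY_sq : SquareIntegrable μ Y)
    (hβ₀ : Measurable β₀) (hβ₀_sq : SquareIntegrable μ β₀)
    (hD_data : IndepFun (fun ω k => (D k ω).diag) (fun ω => (Y ω, β₀ ω)) μ) :
    IsContractiveRecursion μ (fun k ω => errorStep α (gram X) (D k ω))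
      (fun k ω => noiseStep α p (gram X) (D k ω)) (fun ω => betaTilde p X (Y ω))
      (fun k ω => iterate α X D Y β₀ k ω - betaTilde p X (Y ω))
      (opSLin α p (gram X) (expOuter μ (fun ω => betaTilde p X (Y ω))
        fun ω => betaTilde p X (Y ω)))
      (opS α p (gram X) (expOuter μ (fun ω => betaTilde p X (Y ω))
        fun ω => betaTilde p X (Y ω)) 0)
      (1 - α * p * lambdaMin (pPart p (gram X))) 2 where
  toIsAffineRecursion :=
    isAffineRecursion_iterate hl hD hD_indep hY hY_sq hβ₀ hβ₀_sq hD_data α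
  rate_lt_one := sub_lt_self _ (mul_pos (mul_pos hα hp0) hl)
  norm_integral_linear_le k := by
    rw [(hD k).integral_errorStep]
    exact norm_drift_le (isSymm_gram X) hα.le hl h_step
  integral_noise k := (hD k).integral_noiseStep α (gram X)
  integral_linear_conj k A hA := by
    rw [(hD k).integral_errorStep_conj (isSymm_gram X) hA]
    exact (opS_sub_zero α p (gram X) _ A).symm
  norm_apply_le := norm_opSLin_le (posSemidef_gram X) hα.le p.2.1 p.2.2 hl.le
    (lambdaMin_pPart_le_norm (isSymm_gram X) hl) h_step
    (norm_drift_le (isSymm_gram X) hα.le hl h_step) _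
  integral_noise_conj k := (hD k).integral_noiseStep_conj
    (isSymm_gram X) (isSymm_expOuter _) α
  ae_norm_mul_norm_le k := by
    have h_small := mul_norm_le_one_of_step (isSymm_gram X) hα.le hl h_step
    filter_upwards [(hD k).ae_norm_errorStep_le hα.le (gram X),
      (hD k).ae_norm_noiseStep_le hα.le (posSemidef_gram X)] with ω h_error h_noise
    calc ‖errorStep α (gram X) (D k ω)‖ * ‖noiseStep α p (gram X) (D k ω)‖
        ≤ (1 + α * ‖gram X‖) * (α * ‖gram X‖) := by gcongr
      _ ≤ (1 + 1) * 1 := by gcongr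
      _ = 2 := by norm_num

end ErrorRecursion

section MarginalLoss

variable {Ω : Type*} [MeasurableSpace Ω] {μ : Measure Ω} {n d : ℕ} {p : unitInterval}
  {D : Ω → Matrix (Fin d) (Fin d) ℝ}

theorem sqNorm_eq_dotProduct (v : Fin d → ℝ) : sqNorm v = v ⬝ᵥ v := by
  simp only [sqNorm, dotProduct, sq]

theorem sqNorm_sub_mulVec_mulVec {R : Matrix (Fin d) (Fin d) ℝ} (hR : R.IsSymm)
    (X : Matrix (Fin n) (Fin d) ℝ) (y : Fin n → ℝ) (β : Fin d → ℝ) :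
    sqNorm (y - X *ᵥ (R *ᵥ β))
      = y ⬝ᵥ y - 2 * ((Xᵀ *ᵥ y) ⬝ᵥ R *ᵥ β) + β ⬝ᵥ (R * gram X * R) *ᵥ β := by
  have h_cross : y ⬝ᵥ X *ᵥ (R *ᵥ β) = (Xᵀ *ᵥ y) ⬝ᵥ R *ᵥ β := by
    rw [Matrix.dotProduct_mulVec, Matrix.mulVec_transpose]
  have h_quad : X *ᵥ (R *ᵥ β) ⬝ᵥ X *ᵥ (R *ᵥ β) = β ⬝ᵥ (R * gram X * R) *ᵥ β := by
    rw [gram, ← Matrix.mulVec_mulVec, ← Matrix.mulVec_mulVec, ← Matrix.mulVec_mulVec,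
      Matrix.dotProduct_mulVec, Matrix.dotProduct_mulVec β, Matrix.dotProduct_mulVec _ Xᵀ,
      ← Matrix.mulVec_transpose R, hR.eq, ← Matrix.mulVec_transpose Xᵀ, Matrix.transpose_transpose,
      ← Matrix.dotProduct_mulVec]
  rw [sqNorm_eq_dotProduct, ← h_cross, ← h_quad, sub_dotProduct, dotProduct_sub, dotProduct_sub,
    dotProduct_comm (X *ᵥ (R *ᵥ β)) y]
  ring

theorem marginalLoss_eq (hD : IsDropoutMatrix μ p D) (X : Matrix (Fin n) (Fin d) ℝ)
    (y : Fin n → ℝ) (β : Fin d → ℝ) :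
    marginalLoss μ X D y β
      = y ⬝ᵥ y - 2 * (p * ((Xᵀ *ᵥ y) ⬝ᵥ β)) + p * (β ⬝ᵥ pPart p (gram X) *ᵥ β) := by
  have := hD.indep.isProbabilityMeasure
  have h_int := hD.memLp_top.integrable le_top
  have h_conj_int := (hD.memLp_top_conj (gram X)).integrable le_top
  have h_cross_int := (integrable_dotProduct_mulVec h_int (Xᵀ *ᵥ y) β).const_mul 2
  have h_affine_int : Integrable (fun ω => y ⬝ᵥ y - 2 * ((Xᵀ *ᵥ y) ⬝ᵥ D ω *ᵥ β)) μ :=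
    (integrable_const _).sub h_cross_int
  simp only [marginalLoss, sqNorm_sub_mulVec_mulVec (hD.isSymm _)]
  rw [integral_add h_affine_int (integrable_dotProduct_mulVec h_conj_int β β),
    integral_sub (integrable_const _) h_cross_int, integral_const, probReal_univ, one_smul,
    integral_const_mul, integral_dotProduct_mulVec h_int, integral_dotProduct_mulVec h_conj_int,
    hD.integral_eq, hD.integral_conj, Matrix.smul_mulVec, Matrix.smul_mulVec,
    Matrix.one_mulVec, dotProduct_smul, dotProduct_smul, smul_eq_mul, smul_eq_mul]

theorem marginalLoss_betaTilde_lt (hp0 : 0 < p) (hD : IsDropoutMatrix μ p D)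
    {X : Matrix (Fin n) (Fin d) ℝ} (hl : 0 < lambdaMin (pPart p (gram X))) (y : Fin n → ℝ)
    {β : Fin d → ℝ} (hβ : β ≠ betaTilde p X y) :
    marginalLoss μ X D y (betaTilde p X y) < marginalLoss μ X D y β := by
  have h_symm : (pPart p (gram X)).IsSymm := isSymm_pPart p (isSymm_gram X)
  rw [marginalLoss_eq hD, marginalLoss_eq hD, ← pPart_gram_mulVec_betaTilde hl y]
  set b := betaTilde p X y
  -- Completing the square: the two losses differ by `p (β - b)ᵀ 𝕏_p (β - b)`.
  have h_pos : 0 < (p : ℝ) * ((β - b) ⬝ᵥ pPart p (gram X) *ᵥ (β - b)) :=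
    mul_pos hp0 ((mul_pos hl (dotProduct_self_pos (sub_ne_zero.2 hβ))).trans_le
      (lambdaMin_mul_le h_symm _))
  rw [dotProduct_comm _ b, dotProduct_comm _ β]
  simp only [Matrix.mulVec_sub, sub_dotProduct, dotProduct_sub] at h_pos
  rw [dotProduct_mulVec_comm h_symm β b] at h_pos ⊢
  linarith

end MarginalLoss

/-! ### The Ruppert–Polyak averages -/

section Averages

variable {Ω : Type*} [MeasurableSpace Ω] {μ : Measure Ω} {n d : ℕ}

theorem norm_expOuter_betaTilde_le [IsProbabilityMeasure μ] {p : ℝ}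
    {X : Matrix (Fin n) (Fin d) ℝ} (hl : 0 < lambdaMin (pPart p (gram X))) {Y : Ω → Fin n → ℝ}
    (hY : SquareIntegrable μ Y) :
    ‖expOuter μ (fun ω => betaTilde p X (Y ω)) (fun ω => betaTilde p X (Y ω))‖
      ≤ ‖expOuter μ (fun ω => Xᵀ *ᵥ Y ω) (fun ω => Xᵀ *ᵥ Y ω)‖
        / lambdaMin (pPart p (gram X)) ^ 2 := by
  have h_inv := norm_inv_le_of_coercive hl (lambdaMin_mul_le (isSymm_pPart p (isSymm_gram X)))
  have hXY : SquareIntegrable μ fun ω => Xᵀ *ᵥ Y ω := hY.mulVec (memLp_top_const Xᵀ)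
  have h_indep : IndepFun
      (fun _ : Ω => ((pPart p (gram X))⁻¹, (pPart p (gram X))⁻¹))
      (fun ω => (Xᵀ *ᵥ Y ω, Xᵀ *ᵥ Y ω)) μ := indepFun_const_left _ _
  unfold betaTilde
  rw [expOuter_mulVec_mulVec (memLp_top_const _) (memLp_top_const _) hXY hXY h_indep,
    integral_const, probReal_univ, one_smul]
  refine (norm_mul_le_of_le (norm_mul_le_of_le h_inv le_rfl)
    ((norm_transpose _).trans_le h_inv)).trans_eq ?_
  rw [div_eq_mul_inv, ← inv_pow]
  ring

theorem rpAverage_sub {Ω : Type*} {k : ℕ} (hk : 1 ≤ k) (α : ℝ) (X : Matrix (Fin n) (Fin d) ℝ)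
    (D : ℕ → Ω → Matrix (Fin d) (Fin d) ℝ) (Y : Ω → Fin n → ℝ) (β₀ : Ω → Fin d → ℝ)
    (b : Fin d → ℝ) (ω : Ω) :
    rpAverage α X D Y β₀ k ω - b
      = (k : ℝ)⁻¹ • ∑ l ∈ Finset.Icc 1 k, (iterate α X D Y β₀ l ω - b) := by
  have hk₀ : (k : ℝ) ≠ 0 := by positivity
  rw [rpAverage, Finset.sum_sub_distrib, Finset.sum_const, Nat.card_Icc, Nat.add_sub_cancel,
    smul_sub, ← Nat.cast_smul_eq_nsmul ℝ, inv_smul_smul₀ hk₀]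

theorem noise_term_le {k α p l m g B E S : ℝ} (hk : 0 < k) (hα : 0 < α) (hp0 : 0 < p)
    (hp1 : p < 1) (hm : 0 < m) (hml : (1 - p) * m ≤ l) (hE : 0 ≤ E)
    (hS : S ≤ α ^ 2 * p ^ 2 * (1 - p) * g ^ 2 * B) (hB : B ≤ E / l ^ 2) :
    2 * S / (k * (α * p * l) ^ 2) ≤ 2 * g ^ 2 * E / (k * (1 - p) ^ 3 * m ^ 4) := by
  have hp : 0 < 1 - p := sub_pos.2 hp1
  have hl : 0 < l := (mul_pos hp hm).trans_le hml
  calc 2 * S / (k * (α * p * l) ^ 2)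
      ≤ 2 * (α ^ 2 * p ^ 2 * (1 - p) * g ^ 2 * (E / l ^ 2)) / (k * (α * p * l) ^ 2) := by
        gcongr
        exact hS.trans (by gcongr)
    _ = 2 * g ^ 2 * E * (1 - p) / (k * l ^ 4) := by field_simp
    _ ≤ 2 * g ^ 2 * E * (1 - p) / (k * ((1 - p) * m) ^ 4) := by gcongr
    _ = 2 * g ^ 2 * E / (k * (1 - p) ^ 3 * m ^ 4) := by field_simp

theorem transient_term_le {k s t a κ v : ℝ} (hk : 0 < k) (ht : 0 < t) (hts : t ≤ s)
    (hs : s ≤ 1) (ha : 0 ≤ a) (hκ : 0 ≤ κ) (hv : 0 ≤ v) :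
    2 * (a / s ^ 2 + 2 * 2 * κ / s ^ 3) / k ^ 2 ≤ 2 * (a + 6 * κ + v) / (k ^ 2 * t ^ 3) := by
  have hs₀ : 0 < s := ht.trans_le hts
  calc 2 * (a / s ^ 2 + 2 * 2 * κ / s ^ 3) / k ^ 2
      ≤ 2 * (a / s ^ 3 + 2 * 2 * κ / s ^ 3) / k ^ 2 := by
        have h_pow : s ^ 3 ≤ s ^ 2 := pow_le_pow_of_le_one hs₀.le hs (by norm_num)
        gcongr
    _ = 2 * (a + 4 * κ) / (k ^ 2 * s ^ 3) := by
        field_simp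
        ring
    _ ≤ 2 * (a + 6 * κ + v) / (k ^ 2 * t ^ 3) := by
        gcongr ?_ / (k ^ 2 * ?_ ^ 3)
        linarith

theorem integral_sqNorm_le {U : Ω → Fin d → ℝ} (hU : SquareIntegrable μ U) :
    ∫ ω, sqNorm (U ω) ∂μ ≤ d * ‖expOuter μ U U‖ := by
  simp only [sqNorm, sq]
  rw [integral_finsetSum _ fun i _ => hU.integrable_mul hU i i]
  calc ∑ i, ∫ ω, U ω i * U ω i ∂μ
      ≤ ∑ _i : Fin d, ‖expOuter μ U U‖ :=
        Finset.sum_le_sum fun i _ => (le_abs_self _).trans (abs_apply_le_norm (expOuter μ U U) i i)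
    _ = d * ‖expOuter μ U U‖ := by rw [Finset.sum_const, Finset.card_fin, nsmul_eq_mul]

theorem tendsto_div_add_div_sq (a b c₁ c₂ c₃ : ℝ) :
    Tendsto (fun k : ℕ => a / (k * c₁ * c₂) + b / (k ^ 2 * c₃)) atTop (𝓝 0) := by
  have h_inv := tendsto_inv_atTop_nhds_zero_nat (𝕜 := ℝ)
  have h_sum := (h_inv.const_mul (a / (c₁ * c₂))).add ((h_inv.pow 2).const_mul (b / c₃))
  rw [zero_pow two_ne_zero, mul_zero, mul_zero, add_zero] at h_sum
  refine h_sum.congr fun k => ?_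
  ring

theorem tendsto_integral_sqNorm {U : ℕ → Ω → Fin d → ℝ}
    (hU : ∀ᶠ k in atTop, SquareIntegrable μ (U k)) {u : ℕ → ℝ} (hu : Tendsto u atTop (𝓝 0))
    (h_le : ∀ᶠ k in atTop, ‖expOuter μ (U k) (U k)‖ ≤ u k) :
    Tendsto (fun k => ∫ ω, sqNorm (U k ω) ∂μ) atTop (𝓝 0) := by
  have h_lim : Tendsto (fun k => (d : ℝ) * u k) atTop (𝓝 0) := by
    simpa only [mul_zero] using hu.const_mul (d : ℝ)
  refine squeeze_zero' (Eventually.of_forall fun k => integral_nonneg fun ω =>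
    Finset.sum_nonneg fun i _ => sq_nonneg (U k ω i)) ?_ h_lim
  filter_upwards [hU, h_le] with k hk h_norm
  exact (integral_sqNorm_le hk).trans (mul_le_mul_of_nonneg_left h_norm (Nat.cast_nonneg d))

variable [IsProbabilityMeasure μ] {p : unitInterval} {α : ℝ} {X : Matrix (Fin n) (Fin d) ℝ}
  {D : ℕ → Ω → Matrix (Fin d) (Fin d) ℝ} {Y : Ω → Fin n → ℝ} {β₀ : Ω → Fin d → ℝ}

theorem squareIntegrable_rpAverage_sub (hl : 0 < lambdaMin (pPart p (gram X)))
    (hD : ∀ k, IsDropoutMatrix μ p (D k))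
    (hD_indep : iIndepFun (fun k ω => (D k ω).diag) μ)
    (hY : Measurable Y) (hY_sq : SquareIntegrable μ Y)
    (hβ₀ : Measurable β₀) (hβ₀_sq : SquareIntegrable μ β₀)
    (hD_data : IndepFun (fun ω k => (D k ω).diag) (fun ω => (Y ω, β₀ ω)) μ) (α : ℝ)
    {k : ℕ} (hk : 1 ≤ k) :
    SquareIntegrable μ fun ω => rpAverage α X D Y β₀ k ω - betaTilde p X (Y ω) := by
  have h_affine := isAffineRecursion_iterate hl hD hD_indep hY hY_sq hβ₀ hβ₀_sq hD_data α
  simp only [rpAverage_sub hk]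
  intro i
  simp only [Pi.smul_apply, Finset.sum_apply, smul_eq_mul]
  exact (memLp_finsetSum _ fun l _ => h_affine.squareIntegrable l i).const_mul _

theorem norm_expOuter_rpAverage_sub_le (hα : 0 < α) (hp0 : 0 < p) (hp1 : p < 1)
    (hl : 0 < lambdaMin (pPart p (gram X)))
    (h_step : 3 * α * ‖gram X‖ ^ 2 ≤ lambdaMin (pPart p (gram X)))
    (hD : ∀ k, IsDropoutMatrix μ p (D k)) (hD_indep : iIndepFun (fun k ω => (D k ω).diag) μ)
    (hY : Measurable Y) (hY_sq : SquareIntegrable μ Y)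
    (hβ₀ : Measurable β₀) (hβ₀_sq : SquareIntegrable μ β₀)
    (hD_data : IndepFun (fun ω k => (D k ω).diag) (fun ω => (Y ω, β₀ ω)) μ)
    {k : ℕ} (hk : 1 ≤ k) :
    ‖expOuter μ (fun ω => rpAverage α X D Y β₀ k ω - betaTilde p X (Y ω))
        (fun ω => rpAverage α X D Y β₀ k ω - betaTilde p X (Y ω))‖
      ≤ 2 * ‖gram X‖ ^ 2 * ‖expOuter μ (fun ω => Xᵀ *ᵥ Y ω) (fun ω => Xᵀ *ᵥ Y ω)‖
          / (k * (1 - p) ^ 3 * minDiag (gram X) ^ 4)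
        + 2 * constC μ α p X Y β₀ / (k ^ 2 * (α * p * (1 - p) * minDiag (gram X)) ^ 3) := by
  have := nonempty_of_lambdaMin_pos hl
  have hp0' : (0 : ℝ) < p := hp0
  have hp1' : (p : ℝ) < 1 := hp1
  have hm : 0 < minDiag (gram X) := hl.trans_le (lambdaMin_pPart_le_minDiag (isSymm_gram X) p)
  have hml := mul_minDiag_le_lambdaMin_pPart (posSemidef_gram X) p.2.1 p.2.2
  have hk' : (0 : ℝ) < k := by exact_mod_cast hk
  have h_average := (isContractiveRecursion_iterate hα hp0 hl h_step hD hD_indep hY hY_sq hβ₀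
    hβ₀_sq hD_data).norm_expOuter_average_le hk
  simp only [← rpAverage_sub hk, sub_sub_cancel] at h_average
  refine h_average.trans (add_le_add ?_ ?_)
  · exact noise_term_le hk' hα hp0' hp1' hm hml (norm_nonneg _)
      ((hD 0).norm_opS_apply_zero_le (posSemidef_gram X) (isSymm_expOuter _) α)
      (norm_expOuter_betaTilde_le hl hY_sq)
  · refine transient_term_le hk' (by positivity) ?_
      (mul_mul_lambdaMin_pPart_le_one (isSymm_gram X) hα.le hl h_step) (norm_nonneg _)
      (norm_nonneg _) (Finset.sum_nonneg fun i _ => sq_nonneg _)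
    rw [mul_assoc (α * p : ℝ)]
    gcongr

end Averages

end Dropout

end

open Dropout in
theorem mainTheorem3_general {Ω : Type*} [MeasurableSpace Ω] (μ : Measure Ω)
    [IsProbabilityMeasure μ] {n d : ℕ} (X : Matrix (Fin n) (Fin d) ℝ)
    (Y : Ω → Fin n → ℝ) (hY_meas : Measurable Y) (hY_sq : SquareIntegrable μ Y)
    (α : ℝ) (hα : 0 < α) (p : unitInterval) (hp0 : 0 < p) (hp1 : p < 1)
    (D : ℕ → Ω → Matrix (Fin d) (Fin d) ℝ)
    (hD : ∀ k, IsDropoutMatrix μ p (D k))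
    (hD_indep : iIndepFun (fun k ω => (D k ω).diag) μ)
    (β₀ : Ω → Fin d → ℝ) (hβ₀_meas : Measurable β₀) (hβ₀_sq : SquareIntegrable μ β₀)
    (hD_data : IndepFun (fun ω k => (D k ω).diag) (fun ω => (Y ω, β₀ ω)) μ)
    (h_step : α < lambdaMin (pPart p (gram X)) / (3 * ‖gram X‖ ^ 2)) :
    (∀ k y β, β ≠ betaTilde p X y →
      marginalLoss μ X (D k) y (betaTilde p X y) < marginalLoss μ X (D k) y β) ∧
    (∀ k : ℕ, 1 ≤ k →
      SquareIntegrable μ (fun ω => rpAverage α X D Y β₀ k ω - betaTilde p X (Y ω)) ∧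
      ‖expOuter μ (fun ω => rpAverage α X D Y β₀ k ω - betaTilde p X (Y ω))
          (fun ω => rpAverage α X D Y β₀ k ω - betaTilde p X (Y ω))‖
        ≤ 2 * ‖gram X‖ ^ 2 * ‖expOuter μ (fun ω => Xᵀ *ᵥ Y ω) (fun ω => Xᵀ *ᵥ Y ω)‖
            / (k * (1 - p) ^ 3 * minDiag (gram X) ^ 4)
          + 2 * constC μ α p X Y β₀
            / (k ^ 2 * (α * p * (1 - p) * minDiag (gram X)) ^ 3)) ∧
    Tendsto (fun k : ℕ => ∫ ω, sqNorm (rpAverage α X D Y β₀ k ω - betaTilde p X (Y ω)) ∂μ)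
      atTop (𝓝 0) := by
  have hl : 0 < lambdaMin (pPart p (gram X)) := lambdaMin_pos_of_lt_div hα h_step
  have h_small := three_mul_sq_le_of_lt_div hα h_step
  have h_sq (k : ℕ) (hk : 1 ≤ k) := squareIntegrable_rpAverage_sub hl hD hD_indep hY_meas hY_sq
    hβ₀_meas hβ₀_sq hD_data α hk
  have h_le (k : ℕ) (hk : 1 ≤ k) := norm_expOuter_rpAverage_sub_le hα hp0 hp1 hl h_small hD
    hD_indep hY_meas hY_sq hβ₀_meas hβ₀_sq hD_data hk
  exact ⟨fun k y β hβ => marginalLoss_betaTilde_lt hp0 (hD k) hl y hβ,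
    fun k hk => ⟨h_sq k hk, h_le k hk⟩,
    tendsto_integral_sqNorm ((eventually_ge_atTop 1).mono h_sq) (tendsto_div_add_div_sq _ _ _ _ _)
      ((eventually_ge_atTop 1).mono h_le)⟩

open Dropout in
theorem mainTheorem3 {Ω : Type*} [MeasurableSpace Ω] (μ : Measure Ω) [IsProbabilityMeasure μ]
    {n d : ℕ} (X : Matrix (Fin n) (Fin d) ℝ)
    -- linear regression model with centered noise of identity covariance
    (βstar : Fin d → ℝ) (ε Y : Ω → Fin n → ℝ)
    (hY : ∀ ω, Y ω = X *ᵥ βstar + ε ω)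
    (hε_meas : Measurable ε) (hε_sq : SquareIntegrable μ ε)
    (hε_mean : expVec μ ε = 0) (hε_cov : expOuter μ ε ε = 1)
    -- learning rate and dropout probability
    (α : ℝ) (hα : 0 < α) (p : unitInterval) (hp0 : 0 < p) (hp1 : p < 1)
    -- i.i.d. dropout matrices, independent of the data and the initialization
    (D : ℕ → Ω → Matrix (Fin d) (Fin d) ℝ)
    (hD : ∀ k, IsDropoutMatrix μ p (D k))
    (hD_indep : iIndepFun (fun k ω => (D k ω).diag) μ)
    (β₀ : Ω → Fin d → ℝ) (hβ₀_meas : Measurable β₀) (hβ₀_sq : SquareIntegrable μ β₀)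
    (hβ₀_indep : IndepFun β₀ Y μ)
    (hD_data : IndepFun (fun ω k => (D k ω).diag) (fun ω => (Y ω, β₀ ω)) μ)
    -- the model is in reduced form
    (hX : ∀ j, X.col j ≠ 0)
    -- step size conditions
    (hα₁ : α * p * ‖gram X‖ < 1)
    (hα₂ : α < lambdaMin (pPart p (gram X)) / (3 * ‖gram X‖ ^ 2)) :
    -- `β̃` is the unique minimizer of the marginalized loss
    (∀ k y β, β ≠ betaTilde p X y →
      marginalLoss μ X (D k) y (betaTilde p X y) < marginalLoss μ X (D k) y β) ∧
    -- non-asymptotic bound on the second moment of the averages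
    (∀ k : ℕ, 1 ≤ k →
      SquareIntegrable μ (fun ω => rpAverage α X D Y β₀ k ω - betaTilde p X (Y ω)) ∧
      ‖expOuter μ (fun ω => rpAverage α X D Y β₀ k ω - betaTilde p X (Y ω))
          (fun ω => rpAverage α X D Y β₀ k ω - betaTilde p X (Y ω))‖
        ≤ 2 * ‖gram X‖ ^ 2 * ‖expOuter μ (fun ω => Xᵀ *ᵥ Y ω) (fun ω => Xᵀ *ᵥ Y ω)‖
            / (k * (1 - p) ^ 3 * minDiag (gram X) ^ 4)
          + 2 * constC μ α p X Y β₀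
            / (k ^ 2 * (α * p * (1 - p) * minDiag (gram X)) ^ 3)) ∧
    -- convergence in quadratic mean
    Tendsto (fun k : ℕ => ∫ ω, sqNorm (rpAverage α X D Y β₀ k ω - betaTilde p X (Y ω)) ∂μ)
      atTop (𝓝 0) := by
  obtain rfl : Y = fun ω => X *ᵥ βstar + ε ω := funext hY
  exact mainTheorem3_general μ X _ (measurable_const.add hε_meas)
    (SquareIntegrable.add (fun i => memLp_const _) hε_sq) α hα p hp0 hp1 D hD hD_indep β₀
    hβ₀_meas hβ₀_sq hD_data hα₂
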